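/- **Costa's entropy power inequality.** Let $n\ge 1$, let $X$ be a random vector in $\mathbb{R}^n$ that has a probability density with respect to Lebesgue measure, and for every $t>0$ let $Z_t\sim N(0,tI_n)$ be a Gaussian random vector independent of $X$. Put $X_t=X+Z_t$, which has a density $p_t$, and assume that its differential entropy is finite for every $t>0$, i.e. that $p_t\log p_t$ is Lebesgue integrable on $\mathbb{R}^n$ for every $t>0$. Let $$H(X_t)=-\int_{\mathbb{R}^n}p_t(x)\log p_t(x)\,dx,\qquad N(X_t)=\frac{1}{2\pi e}\,e^{(2/n)H(X_t)}.$$ Then $t\mapsto N(X_t)$ is twice differentiable on $(0,\infty)$, and for every $t>0$ $$\frac{d}{dt}N(X_t)\ge 0,\qquad \frac{d^2}{dt^2}N(X_t)\le 0;$$ in particular $t\mapsto N(X_t)$ is concave on $(0,\infty)$. -/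

import Mathlib

open MeasureTheory ProbabilityTheory Set

noncomputable section

/-- A random vector `Y` in `ℝⁿ` has finite differential entropy: its Lebesgue density `f` is such
that `f log f` is Lebesgue integrable. -/
def HasFiniteEntropy {Ω : Type*} [MeasurableSpace Ω] {n : ℕ} (P : Measure Ω)
    (Y : Ω → EuclideanSpace ℝ (Fin n)) : Prop :=
  Integrable (fun x => (pdf Y P volume x).toReal * Real.log (pdf Y P volume x).toReal) volume

/-- Differential entropy `H(Y) = -∫ f log f`, where `f` is the Lebesgue density of `Y`
(and `0 log 0 = 0`). -/
def differentialEntropy {Ω : Type*} [MeasurableSpace Ω] {n : ℕ} (P : Measure Ω)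
    (Y : Ω → EuclideanSpace ℝ (Fin n)) : ℝ :=
  -∫ x, (pdf Y P volume x).toReal * Real.log (pdf Y P volume x).toReal

/-- Entropy power `N(Y) = e^{(2/n) H(Y)} / (2πe)` of a random vector in `ℝⁿ`. -/
def entropyPower {Ω : Type*} [MeasurableSpace Ω] {n : ℕ} (P : Measure Ω)
    (Y : Ω → EuclideanSpace ℝ (Fin n)) : ℝ :=
  1 / (2 * Real.pi * Real.exp 1) * Real.exp (2 / (n : ℝ) * differentialEntropy P Y)

end

/-! Let `μ` be the law of `X`. The density of `X + Z_t` is `p = μ ∗ g_t`, with `g_t` the heat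
kernel, so it is smooth, positive and solves `∂ₜp = ½Δp`. Write `I = ∫ |∇p|²/p` and `J = ∫ p |∇² log
p|²`.

Two pointwise identities carry the proof: `∂ₜ(-p log p) = ½Δ(-p log p) + ½|∇p|²/p`, and
`∂ₜ((∂ᵢp)²/p) = ½Δ((∂ᵢp)²/p) - Σⱼ p(∂ᵢ∂ⱼ log p)²`. The Laplacians integrate to zero, so `H' = I/2`
(de Bruijn, `hasDerivAt_integral_negMulLog_heatFlow`) and `I' = -J` (`hasDerivAt_fisherInfo`). Hence
`N' = N I/n ≥ 0` and `N'' = N (I² - nJ)/n²`. Finally `I² ≤ nJ` (`sq_fisherInfo_le`), by expanding `∫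
p(∂ᵢ∂ᵢ log p + c)² ≥ 0` and choosing `c` well.

The analytic work is to dominate every integrand, uniformly for `t` in `(s/2, 3s/2)`, by a multiple
of `p` at the later time `2s`. A polynomial times `g_t` is at most a constant times `g_{2s}`.
Cauchy–Schwarz then bounds squares and fourth powers of derivatives of `p_t` by `C p_{2s}` times
powers of `p_t`, which absorbs the denominators (`exists_heatFlow_bounds`). Logarithms are handled
by a matching lower bound from Jensen (`exists_abs_log_heatFlow_le`) and by finiteness of the
entropy at time `2s`. -/

/-! ### The heat kernel and its derivatives -/

noncomputable section

/-- The average `∫ k (x - y) dμ(y)` of translates of a kernel `k`. -/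
def kernelAvg {E : Type*} [Sub E] [MeasurableSpace E] (μ : Measure E) (k : E → ℝ) (x : E) : ℝ :=
  ∫ y, k (x - y) ∂μ

/-- The density of the centred Gaussian on `ℝⁿ` with covariance `t I`. -/
def heatKernel {n : ℕ} (t : ℝ) (z : EuclideanSpace ℝ (Fin n)) : ℝ :=
  (2 * Real.pi * t) ^ (-(n : ℝ) / 2) * Real.exp (-‖z‖ ^ 2 / (2 * t))

/-- The weight of `∂ᵢ` of the heat kernel. -/
def heatWeight₁ {n : ℕ} (i : Fin n) (t : ℝ) (z : EuclideanSpace ℝ (Fin n)) : ℝ := -(z i) / t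

/-- The weight of `∂ⱼ∂ᵢ` of the heat kernel. -/
def heatWeight₂ {n : ℕ} (i j : Fin n) (t : ℝ) (z : EuclideanSpace ℝ (Fin n)) : ℝ :=
  z i * z j / t ^ 2 - (if i = j then 1 else 0) / t

/-- The weight of `∂ⱼ∂ⱼ∂ᵢ` of the heat kernel. -/
def heatWeight₃ {n : ℕ} (i j : Fin n) (t : ℝ) (z : EuclideanSpace ℝ (Fin n)) : ℝ :=
  2 * (if i = j then 1 else 0) * z j / t ^ 2 + z i / t ^ 2 - z i * z j ^ 2 / t ^ 3

end

section Kernel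

variable {n : ℕ}

theorem heatKernel_pos {t : ℝ} (ht : 0 < t) (z : EuclideanSpace ℝ (Fin n)) :
    0 < heatKernel t z := by
  unfold heatKernel; positivity

@[fun_prop]
theorem continuous_heatKernel (t : ℝ) :
    Continuous (heatKernel t : EuclideanSpace ℝ (Fin n) → ℝ) := by
  unfold heatKernel; fun_prop

@[fun_prop]
theorem continuous_heatWeight₁ (i : Fin n) (t : ℝ) : Continuous (heatWeight₁ i t) := by
  unfold heatWeight₁; fun_prop

@[fun_prop]
theorem continuous_heatWeight₂ (i j : Fin n) (t : ℝ) : Continuous (heatWeight₂ i j t) := by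
  unfold heatWeight₂; fun_prop

@[fun_prop]
theorem continuous_heatWeight₃ (i j : Fin n) (t : ℝ) : Continuous (heatWeight₃ i j t) := by
  unfold heatWeight₃; fun_prop

theorem hasLineDerivAt_coord (i j : Fin n) (z : EuclideanSpace ℝ (Fin n)) :
    HasLineDerivAt ℝ (fun z : EuclideanSpace ℝ (Fin n) => z i) (if i = j then 1 else 0) z
      (EuclideanSpace.single j 1) := by
  unfold HasLineDerivAt
  have : (fun s : ℝ => (z + s • EuclideanSpace.single j (1 : ℝ)) i)
      = fun s => z i + s * (if i = j then 1 else 0) := by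
    ext s; simp
  rw [this]
  simpa using ((hasDerivAt_id (0 : ℝ)).mul_const (if i = j then (1 : ℝ) else 0)).const_add (z i)

theorem hasLineDerivAt_norm_sq (j : Fin n) (z : EuclideanSpace ℝ (Fin n)) :
    HasLineDerivAt ℝ (fun z : EuclideanSpace ℝ (Fin n) => ‖z‖ ^ 2) (2 * z j) z
      (EuclideanSpace.single j 1) := by
  have h : HasFDerivAt (fun z : EuclideanSpace ℝ (Fin n) => ‖z‖ ^ 2) (2 • innerSL ℝ z) z := by
    exact (hasStrictFDerivAt_norm_sq z).hasFDerivAt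
  have h2 := h.hasLineDerivAt (EuclideanSpace.single j 1)
  convert! h2 using 1
  simp [EuclideanSpace.inner_single_right]

theorem hasLineDerivAt_heatKernel (j : Fin n) (t : ℝ) (z : EuclideanSpace ℝ (Fin n)) :
    HasLineDerivAt ℝ (heatKernel t) (heatWeight₁ j t z * heatKernel t z) z
      (EuclideanSpace.single j 1) := by
  have h : HasDerivAt (fun s : ℝ => ‖z + s • EuclideanSpace.single j (1 : ℝ)‖ ^ 2) (2 * z j) 0 :=
    hasLineDerivAt_norm_sq j z
  have h2 := ((h.neg.div_const (2 * t)).exp).const_mul ((2 * Real.pi * t) ^ (-(n : ℝ) / 2))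
  unfold HasLineDerivAt
  convert! h2 using 1
  simp only [heatWeight₁, heatKernel, Pi.neg_apply, zero_smul, add_zero]
  field_simp

theorem hasLineDerivAt_heatKernel₁ (i j : Fin n) (t : ℝ) (z : EuclideanSpace ℝ (Fin n)) :
    HasLineDerivAt ℝ (fun z => heatWeight₁ i t z * heatKernel t z)
      (heatWeight₂ i j t z * heatKernel t z) z (EuclideanSpace.single j 1) := by
  have h1 : HasDerivAt (fun s : ℝ => (z + s • EuclideanSpace.single j (1 : ℝ)) i) _ 0 :=
    hasLineDerivAt_coord i j z
  have h2 : HasDerivAt (fun s : ℝ => heatKernel t (z + s • EuclideanSpace.single j (1 : ℝ))) _ 0 :=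
    hasLineDerivAt_heatKernel j t z
  have h3 := (h1.neg.div_const t).mul h2
  unfold HasLineDerivAt
  convert! h3 using 1
  simp only [heatWeight₁, heatWeight₂, zero_smul, add_zero, Pi.neg_apply]
  ring

theorem hasLineDerivAt_heatKernel₂ (i j : Fin n) (t : ℝ) (z : EuclideanSpace ℝ (Fin n)) :
    HasLineDerivAt ℝ (fun z => heatWeight₂ i j t z * heatKernel t z)
      (heatWeight₃ i j t z * heatKernel t z) z (EuclideanSpace.single j 1) := by
  have h1 : HasDerivAt (fun s : ℝ => (z + s • EuclideanSpace.single j (1 : ℝ)) i) _ 0 :=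
    hasLineDerivAt_coord i j z
  have h1' : HasDerivAt (fun s : ℝ => (z + s • EuclideanSpace.single j (1 : ℝ)) j) _ 0 :=
    hasLineDerivAt_coord j j z
  have h2 : HasDerivAt (fun s : ℝ => heatKernel t (z + s • EuclideanSpace.single j (1 : ℝ))) _ 0 :=
    hasLineDerivAt_heatKernel j t z
  have h3 := (((h1.mul h1').div_const (t ^ 2)).sub_const ((if i = j then 1 else 0) / t)).mul h2
  unfold HasLineDerivAt
  convert! h3 using 1
  simp only [heatWeight₁, heatWeight₃, zero_smul, add_zero, if_true, Pi.mul_apply]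
  split_ifs with h
  · subst h; ring
  · ring

/-- The heat equation: both sides have weight `½(‖z‖²/t² - n/t)`. -/
theorem hasDerivAt_heatKernel {t : ℝ} (ht : 0 < t) (z : EuclideanSpace ℝ (Fin n)) :
    HasDerivAt (fun t => heatKernel t z) (1 / 2 * ∑ j, heatWeight₂ j j t z * heatKernel t z) t := by
  have h1 : HasDerivAt (fun t : ℝ => (2 * Real.pi * t) ^ (-(n : ℝ) / 2))
      ((2 * Real.pi) * (-(n : ℝ) / 2) * (2 * Real.pi * t) ^ (-(n : ℝ) / 2 - 1)) t := by
    have := ((hasDerivAt_id t).const_mul (2 * Real.pi)).rpow_const (p := -(n : ℝ) / 2)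
      (Or.inl (by simp [ht.ne', Real.pi_ne_zero]))
    simpa using this
  have h2 : HasDerivAt (fun t : ℝ => -‖z‖ ^ 2 / (2 * t)) (‖z‖ ^ 2 / (2 * t ^ 2)) t := by
    have := (((hasDerivAt_id t).const_mul 2).fun_inv (by simp [ht.ne'])).const_mul (-‖z‖ ^ 2)
    convert! this using 1
    simp only [id]
    field_simp
  have h3 := h1.mul h2.exp
  convert! h3 using 1
  rw [← Finset.sum_mul]
  have hs : ∑ j, heatWeight₂ j j t z = ‖z‖ ^ 2 / t ^ 2 - n / t := by
    rw [EuclideanSpace.real_norm_sq_eq, Finset.sum_div]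
    simp only [heatWeight₂, if_true, Finset.sum_sub_distrib, ← pow_two]
    simp [div_eq_mul_inv]
  rw [hs, heatKernel, Real.rpow_sub_one (by positivity)]
  field_simp
  ring

/-- The heat equation differentiated in direction `i`. It is the reason why only third derivatives
of the form `∂ⱼ∂ⱼ∂ᵢ` are needed. -/
theorem hasDerivAt_heatKernel₁ (i : Fin n) {t : ℝ} (ht : 0 < t) (z : EuclideanSpace ℝ (Fin n)) :
    HasDerivAt (fun t => heatWeight₁ i t z * heatKernel t z)
      (1 / 2 * ∑ j, heatWeight₃ i j t z * heatKernel t z) t := by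
  have h1 : HasDerivAt (fun t : ℝ => -(z i) / t) (z i / t ^ 2) t := by
    have := ((hasDerivAt_id t).fun_inv ht.ne').const_mul (-(z i))
    convert! this using 1
    simp only [id]
    field_simp
  have h3 := h1.mul (hasDerivAt_heatKernel ht z)
  convert! h3 using 1
  rw [← Finset.sum_mul, ← Finset.sum_mul]
  have hs : ∑ j, heatWeight₃ i j t z = 2 * z i / t ^ 2 - z i / t * ∑ j, heatWeight₂ j j t z := by
    simp only [heatWeight₃, heatWeight₂, Finset.mul_sum]
    have h j : 2 * (if i = j then 1 else 0) * z j / t ^ 2 + z i / t ^ 2 - z i * z j ^ 2 / t ^ 3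
        = (if i = j then 2 * z j / t ^ 2 else 0)
          - z i / t * (z j * z j / t ^ 2 - (if j = j then 1 else 0) / t) := by
      rw [if_pos rfl]
      split_ifs with h <;> field_simp <;> ring
    rw [Finset.sum_congr rfl fun j _ => h j, Finset.sum_sub_distrib]
    simp
  rw [hs]
  ring

end Kernel

/-! ### Gaussian bounds uniform in a time window -/

section KernelBounds

variable {n : ℕ}

/-- The power is at most `m! e^{1+r}`, and the linear exponent is absorbed by the gap `1/(3s) -
1/(4s) = 1/(12s)` after completing the square. The rates come from `2t < 3s` in the window and from
the target time `2s`. -/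
theorem one_add_pow_mul_exp_le (m : ℕ) {s r : ℝ} (hs : 0 < s) (hr : 0 ≤ r) :
    (1 + r) ^ m * Real.exp (-r ^ 2 / (3 * s)) ≤
      m.factorial * Real.exp (1 + 3 * s) * Real.exp (-r ^ 2 / (4 * s)) := by
  have h1 : (1 + r) ^ m ≤ m.factorial * Real.exp (1 + r) := by
    have := Real.pow_div_factorial_le_exp (1 + r) (by positivity) m
    rwa [div_le_iff₀' (by positivity)] at this
  have h2 : Real.exp (1 + r) * Real.exp (-r ^ 2 / (3 * s)) ≤
      Real.exp (1 + 3 * s) * Real.exp (-r ^ 2 / (4 * s)) := by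
    rw [← Real.exp_add, ← Real.exp_add, Real.exp_le_exp]
    have : 1 + 3 * s + -r ^ 2 / (4 * s) - (1 + r + -r ^ 2 / (3 * s))
        = (r - 6 * s) ^ 2 / (12 * s) := by
      field_simp; ring
    have h3 : 0 ≤ (r - 6 * s) ^ 2 / (12 * s) := by positivity
    linarith
  calc _ ≤ m.factorial * Real.exp (1 + r) * Real.exp (-r ^ 2 / (3 * s)) := by gcongr
    _ = m.factorial * (Real.exp (1 + r) * Real.exp (-r ^ 2 / (3 * s))) := by ring
    _ ≤ m.factorial * (Real.exp (1 + 3 * s) * Real.exp (-r ^ 2 / (4 * s))) := by gcongr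
    _ = _ := by ring

theorem exists_one_add_pow_mul_heatKernel_le (m : ℕ) {s : ℝ} (hs : 0 < s) :
    ∃ C > 0, ∀ t ∈ Ioo (s / 2) (3 * s / 2), ∀ z : EuclideanSpace ℝ (Fin n),
      (1 + ‖z‖) ^ m * heatKernel t z ≤ C * heatKernel (2 * s) z := by
  refine ⟨(Real.pi * s) ^ (-(n : ℝ) / 2) * (m.factorial * Real.exp (1 + 3 * s)) /
    (2 * Real.pi * (2 * s)) ^ (-(n : ℝ) / 2), by positivity, fun t ht z => ?_⟩
  have ht0 : 0 < t := by linarith [ht.1]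
  have h1 : (2 * Real.pi * t) ^ (-(n : ℝ) / 2) ≤ (Real.pi * s) ^ (-(n : ℝ) / 2) := by
    apply Real.rpow_le_rpow_of_nonpos (by positivity)
    · nlinarith [Real.pi_pos, ht.1]
    · have : (0 : ℝ) ≤ n := by positivity
      linarith
  have h2 : Real.exp (-‖z‖ ^ 2 / (2 * t)) ≤ Real.exp (-‖z‖ ^ 2 / (3 * s)) := by
    rw [Real.exp_le_exp, neg_div, neg_div, neg_le_neg_iff]
    exact div_le_div_of_nonneg_left (by positivity) (by positivity) (by linarith [ht.2])
  have h3 := one_add_pow_mul_exp_le m hs (norm_nonneg z)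
  have h4 : (0 : ℝ) < (2 * Real.pi * (2 * s)) ^ (-(n : ℝ) / 2) := by positivity
  unfold heatKernel
  calc _ ≤ (1 + ‖z‖) ^ m * ((Real.pi * s) ^ (-(n : ℝ) / 2) * Real.exp (-‖z‖ ^ 2 / (3 * s))) := by
        gcongr
    _ = (Real.pi * s) ^ (-(n : ℝ) / 2) * ((1 + ‖z‖) ^ m * Real.exp (-‖z‖ ^ 2 / (3 * s))) := by
        ring
    _ ≤ (Real.pi * s) ^ (-(n : ℝ) / 2) *
        (m.factorial * Real.exp (1 + 3 * s) * Real.exp (-‖z‖ ^ 2 / (4 * s))) := by gcongr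
    _ = _ := by
      rw [div_mul_eq_mul_div, eq_div_iff h4.ne']
      ring_nf

/-- The fourth power turns the rate `1/(4s)` into `1/s`, which exceeds `1/(2t)` because `t > s/2`. A
convex power is used so that Jensen can pass the bound to averages. -/
theorem exists_mul_heatKernel_pow_le {s : ℝ} (hs : 0 < s) :
    ∃ c > 0, ∀ t ∈ Ioo (s / 2) (3 * s / 2), ∀ z : EuclideanSpace ℝ (Fin n),
      c * heatKernel (2 * s) z ^ 4 ≤ heatKernel t z := by
  refine ⟨(2 * Real.pi * (3 * s / 2)) ^ (-(n : ℝ) / 2) /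
    ((2 * Real.pi * (2 * s)) ^ (-(n : ℝ) / 2)) ^ 4, by positivity, fun t ht z => ?_⟩
  have ht0 : 0 < t := by linarith [ht.1]
  have h1 : (2 * Real.pi * (3 * s / 2)) ^ (-(n : ℝ) / 2) ≤ (2 * Real.pi * t) ^ (-(n : ℝ) / 2) := by
    apply Real.rpow_le_rpow_of_nonpos (by positivity)
    · nlinarith [Real.pi_pos, ht.2]
    · have : (0 : ℝ) ≤ n := by positivity
      linarith
  have h2 : Real.exp (-‖z‖ ^ 2 / (2 * (2 * s))) ^ 4 ≤ Real.exp (-‖z‖ ^ 2 / (2 * t)) := by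
    rw [← Real.exp_nat_mul, Real.exp_le_exp]
    have : ((4 : ℕ) : ℝ) * (-‖z‖ ^ 2 / (2 * (2 * s))) = -(‖z‖ ^ 2 / s) := by
      push_cast; field_simp; norm_num [mul_comm]
    rw [this, neg_div, neg_le_neg_iff]
    exact div_le_div_of_nonneg_left (by positivity) (by positivity) (by linarith [ht.1])
  have h4 : (0 : ℝ) < (2 * Real.pi * (2 * s)) ^ (-(n : ℝ) / 2) := by positivity
  unfold heatKernel
  calc _ = (2 * Real.pi * (3 * s / 2)) ^ (-(n : ℝ) / 2) *
        Real.exp (-‖z‖ ^ 2 / (2 * (2 * s))) ^ 4 := by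
        rw [mul_pow, ← mul_assoc, div_mul_cancel₀ _ (by positivity)]
    _ ≤ _ := by gcongr

theorem heatKernel_le_zero {t : ℝ} (ht : 0 < t) (z : EuclideanSpace ℝ (Fin n)) :
    heatKernel t z ≤ heatKernel t (0 : EuclideanSpace ℝ (Fin n)) := by
  unfold heatKernel
  gcongr
  simp

/-- Continuous functions of at most cubic growth with constant `D`. -/
def HasCubicGrowth (D : ℝ) (W : EuclideanSpace ℝ (Fin n) → ℝ) : Prop :=
  Continuous W ∧ ∀ z, |W z| ≤ D * (1 + ‖z‖) ^ 3

theorem exists_hasCubicGrowth (n : ℕ) {s : ℝ} (hs : 0 < s) :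
    ∃ D ≥ 1, ∀ t > s / 2, HasCubicGrowth D (fun _ : EuclideanSpace ℝ (Fin n) => 1) ∧
      (∀ i : Fin n, HasCubicGrowth D (heatWeight₁ i t)) ∧
      (∀ i j : Fin n, HasCubicGrowth D (heatWeight₂ i j t)) ∧
      (∀ i j : Fin n, HasCubicGrowth D (heatWeight₃ i j t)) := by
  set τ := 1 + 2 / s with hτ
  have hτ1 : 1 ≤ τ := by rw [hτ]; linarith [show 0 < 2 / s by positivity]
  -- Since `1/t ≤ τ`, each factor `zᵢ/t` or `1/t` is at most `τ(1+‖z‖)`. Every weight is a sum of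
  -- such products of degree at most three, with coefficients of total size at most 4 (attained by
  -- `heatWeight₃`).
  refine ⟨4 * τ ^ 3, by nlinarith [one_le_pow₀ hτ1 (n := 3)], fun t ht => ?_⟩
  have ht0 : 0 < t := by linarith
  have hu : t⁻¹ ≤ τ := by
    have : t⁻¹ ≤ (s / 2)⁻¹ := inv_anti₀ (by positivity) ht.le
    rw [inv_div] at this
    linarith
  have hu0 : 0 ≤ t⁻¹ := by positivity
  have hz (z : EuclideanSpace ℝ (Fin n)) (i : Fin n) : |z i| ≤ 1 + ‖z‖ := by
    have := PiLp.norm_apply_le z i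
    rw [Real.norm_eq_abs] at this
    linarith
  have hδ (i j : Fin n) : |(if i = j then (1 : ℝ) else 0)| ≤ 1 := by split_ifs <;> simp
  refine ⟨⟨by fun_prop, fun z => ?_⟩, fun i => ⟨by fun_prop, fun z => ?_⟩,
    fun i j => ⟨by fun_prop, fun z => ?_⟩, fun i j => ⟨by fun_prop, fun z => ?_⟩⟩
  all_goals
    have hr : 1 ≤ 1 + ‖z‖ := by linarith [norm_nonneg z]
    have hx : 1 ≤ τ * (1 + ‖z‖) := one_le_mul_of_one_le_of_one_le hτ1 hr
    have hτr : τ ≤ τ * (1 + ‖z‖) := le_mul_of_one_le_right (by linarith) hr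
    have hrr : 4 * τ ^ 3 * (1 + ‖z‖) ^ 3 = 4 * (τ * (1 + ‖z‖)) ^ 3 := by ring
    rw [hrr]
    have hp3 := one_le_pow₀ hx (n := 3)
    have hp2 := pow_le_pow_right₀ hx (show 2 ≤ 3 by norm_num)
    have hp1 := pow_le_pow_right₀ hx (show 1 ≤ 3 by norm_num)
    have hq1 := pow_le_pow_right₀ hx (show 1 ≤ 2 by norm_num)
    rw [pow_one] at hp1 hq1
    have hzt (i : Fin n) : |z i * t⁻¹| ≤ τ * (1 + ‖z‖) := by
      rw [abs_mul, abs_of_nonneg hu0, mul_comm]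
      exact mul_le_mul hu (hz z i) (abs_nonneg _) (by linarith)
    have hut : |t⁻¹| ≤ τ * (1 + ‖z‖) := by rw [abs_of_nonneg hu0]; linarith
    have hmul {a b c d : ℝ} (h1 : |a| ≤ c) (h2 : |b| ≤ d) : |a * b| ≤ c * d := by
      rw [abs_mul]; exact mul_le_mul h1 h2 (abs_nonneg _) ((abs_nonneg _).trans h1)
  · rw [abs_one]; linarith
  · have := hzt i
    rw [heatWeight₁, div_eq_mul_inv, neg_mul, abs_neg]
    linarith
  · have e : heatWeight₂ i j t z = (z i * t⁻¹) * (z j * t⁻¹) - (if i = j then 1 else 0) * t⁻¹ := by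
      simp only [heatWeight₂]; field_simp
    have h1 := hmul (hzt i) (hzt j)
    have h2 := hmul (hδ i j) hut
    rw [e]
    refine (abs_sub _ _).trans ?_
    nlinarith
  · have e : heatWeight₃ i j t z = 2 * ((if i = j then 1 else 0) * ((z j * t⁻¹) * t⁻¹))
        + (z i * t⁻¹) * t⁻¹ - (z i * t⁻¹) * ((z j * t⁻¹) * (z j * t⁻¹)) := by
      simp only [heatWeight₃]; field_simp
    have h1 := hmul (hδ i j) (hmul (hzt j) hut)
    have h2 := hmul (hzt i) hut
    have h3 := hmul (hzt i) (hmul (hzt j) (hzt j))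
    rw [e]
    rw [abs_le] at h1 h2 h3 ⊢
    constructor <;> nlinarith

theorem exists_abs_pow_mul_heatKernel_le {D s : ℝ} (hD : 1 ≤ D) (hs : 0 < s) :
    ∃ C > 0, ∀ t ∈ Ioo (s / 2) (3 * s / 2), ∀ W : EuclideanSpace ℝ (Fin n) → ℝ,
      HasCubicGrowth D W → ∀ m ≤ 4, ∀ z, |W z| ^ m * heatKernel t z ≤ C * heatKernel (2 * s) z := by
  -- Fourth powers of weights of cubic growth have degree 12.
  obtain ⟨C, hC, h⟩ := exists_one_add_pow_mul_heatKernel_le (n := n) 12 hs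
  refine ⟨D ^ 4 * C, by positivity, fun t ht W hW m hm z => ?_⟩
  have hk := heatKernel_pos (show 0 < t by linarith [ht.1]) z
  have hr : 1 ≤ 1 + ‖z‖ := by linarith [norm_nonneg z]
  have h1 : |W z| ^ m ≤ D ^ 4 * (1 + ‖z‖) ^ 12 := by
    calc |W z| ^ m ≤ (D * (1 + ‖z‖) ^ 3) ^ m := by gcongr; exact hW.2 z
      _ ≤ (D * (1 + ‖z‖) ^ 3) ^ 4 := by
        apply pow_le_pow_right₀ _ hm
        exact one_le_mul_of_one_le_of_one_le hD (one_le_pow₀ hr)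
      _ = _ := by ring
  calc _ ≤ D ^ 4 * (1 + ‖z‖) ^ 12 * heatKernel t z := by gcongr
    _ = D ^ 4 * ((1 + ‖z‖) ^ 12 * heatKernel t z) := by ring
    _ ≤ D ^ 4 * (C * heatKernel (2 * s) z) :=
        mul_le_mul_of_nonneg_left (h t ht z) (by positivity)
    _ = _ := by ring

end KernelBounds

/-! ### Averages of translated kernels -/

section KernelAvg

variable {E : Type*} [NormedAddCommGroup E] [MeasurableSpace E] [BorelSpace E]
  [SecondCountableTopology E] {μ : Measure E} [IsProbabilityMeasure μ]

theorem integrable_translate {k : E → ℝ} (hk : Continuous k) {C : ℝ} (hC : ∀ z, |k z| ≤ C) (x : E) :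
    Integrable (fun y => k (x - y)) μ :=
  Integrable.of_bound (by fun_prop) C (ae_of_all _ fun y => hC _)

theorem measurable_kernelAvg {k : E → ℝ} (hk : Continuous k) : Measurable (kernelAvg μ k) := by
  have h : StronglyMeasurable (fun p : E × E => k (p.1 - p.2)) :=
    (show Continuous fun p : E × E => k (p.1 - p.2) by fun_prop).stronglyMeasurable
  exact h.integral_prod_right'.measurable

theorem kernelAvg_mono {k l : E → ℝ} (hk : Continuous k) (hl : Continuous l) {C D : ℝ}
    (hC : ∀ z, |k z| ≤ C) (hD : ∀ z, |l z| ≤ D) (h : ∀ z, k z ≤ l z) (x : E) :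
    kernelAvg μ k x ≤ kernelAvg μ l x :=
  integral_mono (integrable_translate hk hC x) (integrable_translate hl hD x) fun _ => h _

theorem kernelAvg_pos {k : E → ℝ} (hk : Continuous k) {C : ℝ} (hC : ∀ z, |k z| ≤ C)
    (h : ∀ z, 0 < k z) (x : E) : 0 < kernelAvg μ k x := by
  unfold kernelAvg
  rw [integral_pos_iff_support_of_nonneg (fun y => (h _).le) (integrable_translate hk hC x)]
  have : Function.support (fun y => k (x - y)) = univ := by
    ext y; simp [(h (x - y)).ne']
  simp [this]

/-- Differentiation under the integral; as `μ` is finite, a constant bound on `k'` dominates. -/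
theorem hasLineDerivAt_kernelAvg [NormedSpace ℝ E] {k k' : E → ℝ} (hk : Continuous k)
    (hk' : Continuous k') {C C' : ℝ} (hC : ∀ z, |k z| ≤ C) (hC' : ∀ z, |k' z| ≤ C') {v : E}
    (h : ∀ z, HasLineDerivAt ℝ k (k' z) z v) (x : E) :
    HasLineDerivAt ℝ (kernelAvg μ k) (kernelAvg μ k' x) x v := by
  have hd (y : E) (s : ℝ) :
      HasDerivAt (fun s : ℝ => k (x + s • v - y)) (k' (x + s • v - y)) s := by
    have h1 : HasDerivAt (fun r : ℝ => k (x + s • v - y + r • v)) (k' (x + s • v - y)) 0 :=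
      h (x + s • v - y)
    have h2 := HasDerivAt.comp_sub_const (x := s) (a := s)
      (f := fun r : ℝ => k (x + s • v - y + r • v)) (by simpa using h1)
    refine h2.congr_of_eventuallyEq (Filter.Eventually.of_forall fun r => ?_)
    simp only [sub_smul]
    congr 1
    abel
  have := (hasDerivAt_integral_of_dominated_loc_of_deriv_le (μ := μ) (x₀ := (0 : ℝ))
    (s := univ) (F := fun s y => k (x + s • v - y)) (F' := fun s y => k' (x + s • v - y))
    (bound := fun _ => C') Filter.univ_mem
    (Filter.Eventually.of_forall fun s => by fun_prop)
    (integrable_translate hk hC _) (by fun_prop)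
    (ae_of_all _ fun y s _ => hC' _) (integrable_const _)
    (ae_of_all _ fun y s _ => hd y s)).2
  unfold HasLineDerivAt
  convert! this using 1
  simp [kernelAvg]

theorem hasDerivAt_kernelAvg {k k' : ℝ → E → ℝ} {t : ℝ} {s : Set ℝ} (hs : s ∈ nhds t)
    (hk : ∀ t, Continuous (k t)) (hk' : Continuous (k' t)) {C C' : ℝ}
    (hC : ∀ z, |k t z| ≤ C) (hC' : ∀ r ∈ s, ∀ z, |k' r z| ≤ C')
    (h : ∀ r ∈ s, ∀ z, HasDerivAt (fun t => k t z) (k' r z) r) (x : E) :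
    HasDerivAt (fun t => kernelAvg μ (k t) x) (kernelAvg μ (k' t) x) t :=
  (hasDerivAt_integral_of_dominated_loc_of_deriv_le (μ := μ) (x₀ := t)
    (s := s) (F := fun s y => k s (x - y)) (F' := fun s y => k' s (x - y))
    (bound := fun _ => C') hs
    (Filter.Eventually.of_forall fun s => by have := hk s; fun_prop)
    (integrable_translate (hk t) hC _) (by fun_prop)
    (ae_of_all _ fun y s hs => hC' s hs _) (integrable_const _)
    (ae_of_all _ fun y s hs => h s hs _)).2

/-- Cauchy–Schwarz, obtained from nonnegativity of the variance of `W` about its weighted mean `B /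
P`. -/
theorem sq_kernelAvg_mul_le {W k : E → ℝ} (hW : Continuous W) (hk : Continuous k) {C C' C'' : ℝ}
    (hC : ∀ z, |k z| ≤ C) (hC' : ∀ z, |W z * k z| ≤ C') (hC'' : ∀ z, |W z ^ 2 * k z| ≤ C'')
    (hpos : ∀ z, 0 < k z) (x : E) :
    kernelAvg μ (fun z => W z * k z) x ^ 2 ≤
      kernelAvg μ (fun z => W z ^ 2 * k z) x * kernelAvg μ k x := by
  have hP : 0 < kernelAvg μ k x := kernelAvg_pos hk hC hpos x
  have i0 := integrable_translate (μ := μ) hk hC x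
  have i1 : Integrable (fun y => W (x - y) * k (x - y)) μ :=
    integrable_translate (hW.mul hk) hC' x
  have i2 : Integrable (fun y => W (x - y) ^ 2 * k (x - y)) μ :=
    integrable_translate ((hW.pow 2).mul hk) hC'' x
  set P := kernelAvg μ k x
  set B := kernelAvg μ (fun z => W z * k z) x
  set A := kernelAvg μ (fun z => W z ^ 2 * k z) x
  have h : 0 ≤ ∫ y, (W (x - y) - B / P) ^ 2 * k (x - y) ∂μ :=
    integral_nonneg fun y => mul_nonneg (sq_nonneg _) (hpos _).le
  have e : ∫ y, (W (x - y) - B / P) ^ 2 * k (x - y) ∂μ = A - 2 * (B / P) * B + (B / P) ^ 2 * P := by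
    have : ∀ y, (W (x - y) - B / P) ^ 2 * k (x - y) = (W (x - y) ^ 2 * k (x - y)
        - 2 * (B / P) * (W (x - y) * k (x - y))) + (B / P) ^ 2 * k (x - y) := fun y => by ring
    have i3 : Integrable (fun y => W (x - y) ^ 2 * k (x - y)
        - 2 * (B / P) * (W (x - y) * k (x - y))) μ := i2.sub (i1.const_mul _)
    simp_rw [this]
    rw [integral_add i3 (i0.const_mul _),
      integral_sub i2 (i1.const_mul _), integral_const_mul, integral_const_mul]
    rfl
  rw [e] at h
  have e2 : A - 2 * (B / P) * B + (B / P) ^ 2 * P = (A * P - B ^ 2) / P := by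
    field_simp; ring
  rw [e2] at h
  have := mul_nonneg h hP.le
  rw [div_mul_cancel₀ _ hP.ne'] at this
  linarith

end KernelAvg

/-! ### The heat flow: derivatives and pointwise bounds -/

noncomputable section

/-- The density of `μ ∗ N(0, t I)`. -/
def heatFlow {n : ℕ} (μ : Measure (EuclideanSpace ℝ (Fin n))) (t : ℝ)
    (x : EuclideanSpace ℝ (Fin n)) : ℝ := kernelAvg μ (heatKernel t) x

/-- The derivative `∂ᵢ` of the density of `μ ∗ N(0, t I)`. -/
def heatFlow₁ {n : ℕ} (μ : Measure (EuclideanSpace ℝ (Fin n))) (i : Fin n) (t : ℝ)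
    (x : EuclideanSpace ℝ (Fin n)) : ℝ :=
  kernelAvg μ (fun z => heatWeight₁ i t z * heatKernel t z) x

/-- The derivative `∂ⱼ∂ᵢ` of the density of `μ ∗ N(0, t I)`. -/
def heatFlow₂ {n : ℕ} (μ : Measure (EuclideanSpace ℝ (Fin n))) (i j : Fin n) (t : ℝ)
    (x : EuclideanSpace ℝ (Fin n)) : ℝ :=
  kernelAvg μ (fun z => heatWeight₂ i j t z * heatKernel t z) x

/-- The derivative `∂ⱼ∂ⱼ∂ᵢ` of the density of `μ ∗ N(0, t I)`. -/
def heatFlow₃ {n : ℕ} (μ : Measure (EuclideanSpace ℝ (Fin n))) (i j : Fin n) (t : ℝ)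
    (x : EuclideanSpace ℝ (Fin n)) : ℝ :=
  kernelAvg μ (fun z => heatWeight₃ i j t z * heatKernel t z) x

end

section HeatFlow

variable {n : ℕ} {μ : Measure (EuclideanSpace ℝ (Fin n))}

@[fun_prop]
theorem measurable_heatFlow [IsProbabilityMeasure μ] (t : ℝ) : Measurable (heatFlow μ t) :=
  measurable_kernelAvg (by fun_prop)

@[fun_prop]
theorem measurable_heatFlow₁ [IsProbabilityMeasure μ] (i : Fin n) (t : ℝ) :
    Measurable (heatFlow₁ μ i t) :=
  measurable_kernelAvg (by fun_prop)

@[fun_prop]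
theorem measurable_heatFlow₂ [IsProbabilityMeasure μ] (i j : Fin n) (t : ℝ) :
    Measurable (heatFlow₂ μ i j t) :=
  measurable_kernelAvg (by fun_prop)

@[fun_prop]
theorem measurable_heatFlow₃ [IsProbabilityMeasure μ] (i j : Fin n) (t : ℝ) :
    Measurable (heatFlow₃ μ i j t) :=
  measurable_kernelAvg (by fun_prop)

theorem abs_heatKernel_le {t : ℝ} (ht : 0 < t) (z : EuclideanSpace ℝ (Fin n)) :
    |heatKernel t z| ≤ heatKernel t (0 : EuclideanSpace ℝ (Fin n)) := by
  rw [abs_of_pos (heatKernel_pos ht z)]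
  exact heatKernel_le_zero ht z

theorem heatFlow_pos [IsProbabilityMeasure μ] {t : ℝ} (ht : 0 < t)
    (x : EuclideanSpace ℝ (Fin n)) : 0 < heatFlow μ t x :=
  kernelAvg_pos (by fun_prop) (abs_heatKernel_le ht) (heatKernel_pos ht) x

theorem exists_abs_mul_heatKernel_le (n : ℕ) {s : ℝ} (hs : 0 < s) :
    ∃ C, ∀ t ∈ Ioo (s / 2) (3 * s / 2), ∀ z : EuclideanSpace ℝ (Fin n),
      (∀ i, |heatWeight₁ i t z * heatKernel t z| ≤ C) ∧
      (∀ i j, |heatWeight₂ i j t z * heatKernel t z| ≤ C) ∧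
      (∀ i j, |heatWeight₃ i j t z * heatKernel t z| ≤ C) := by
  obtain ⟨D, hD, hW⟩ := exists_hasCubicGrowth n hs
  obtain ⟨C, hC, h⟩ := exists_abs_pow_mul_heatKernel_le (n := n) hD hs
  refine ⟨C * heatKernel (2 * s) (0 : EuclideanSpace ℝ (Fin n)), fun t ht z => ?_⟩
  have ht0 : 0 < t := by linarith [ht.1]
  have key (W : EuclideanSpace ℝ (Fin n) → ℝ) (hW : HasCubicGrowth D W) :
      |W z * heatKernel t z| ≤ C * heatKernel (2 * s) (0 : EuclideanSpace ℝ (Fin n)) := by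
    have h1 := h t ht W hW 1 (by norm_num) z
    rw [pow_one] at h1
    rw [abs_mul, abs_of_pos (heatKernel_pos ht0 z)]
    exact h1.trans (mul_le_mul_of_nonneg_left (heatKernel_le_zero (by positivity) z) hC.le)
  obtain ⟨-, h1, h2, h3⟩ := hW t ht.1
  exact ⟨fun i => key _ (h1 i), fun i j => key _ (h2 i j), fun i j => key _ (h3 i j)⟩

theorem mem_Ioo_window {t : ℝ} (ht : 0 < t) : t ∈ Ioo (t / 2) (3 * t / 2) :=
  ⟨by linarith, by linarith⟩

variable [IsProbabilityMeasure μ]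

theorem hasLineDerivAt_heatFlow (j : Fin n) {t : ℝ} (ht : 0 < t) (x : EuclideanSpace ℝ (Fin n)) :
    HasLineDerivAt ℝ (heatFlow μ t) (heatFlow₁ μ j t x) x (EuclideanSpace.single j 1) := by
  obtain ⟨C, hC⟩ := exists_abs_mul_heatKernel_le n ht
  exact hasLineDerivAt_kernelAvg (by fun_prop) (by fun_prop) (abs_heatKernel_le ht)
    (fun z => (hC t (mem_Ioo_window ht) z).1 j) (hasLineDerivAt_heatKernel j t) x

theorem hasLineDerivAt_heatFlow₁ (i j : Fin n) {t : ℝ} (ht : 0 < t)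
    (x : EuclideanSpace ℝ (Fin n)) :
    HasLineDerivAt ℝ (heatFlow₁ μ i t) (heatFlow₂ μ i j t x) x (EuclideanSpace.single j 1) := by
  obtain ⟨C, hC⟩ := exists_abs_mul_heatKernel_le n ht
  exact hasLineDerivAt_kernelAvg (by fun_prop) (by fun_prop)
    (fun z => (hC t (mem_Ioo_window ht) z).1 i)
    (fun z => (hC t (mem_Ioo_window ht) z).2.1 i j) (hasLineDerivAt_heatKernel₁ i j t) x

theorem hasLineDerivAt_heatFlow₂ (i j : Fin n) {t : ℝ} (ht : 0 < t)
    (x : EuclideanSpace ℝ (Fin n)) :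
    HasLineDerivAt ℝ (heatFlow₂ μ i j t) (heatFlow₃ μ i j t x) x (EuclideanSpace.single j 1) := by
  obtain ⟨C, hC⟩ := exists_abs_mul_heatKernel_le n ht
  exact hasLineDerivAt_kernelAvg (by fun_prop) (by fun_prop)
    (fun z => (hC t (mem_Ioo_window ht) z).2.1 i j)
    (fun z => (hC t (mem_Ioo_window ht) z).2.2 i j) (hasLineDerivAt_heatKernel₂ i j t) x

theorem abs_half_sum_le {f : Fin n → ℝ} {C : ℝ} (h : ∀ j, |f j| ≤ C) :
    |1 / 2 * ∑ j, f j| ≤ 1 / 2 * (n * C) := by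
  rw [abs_mul, abs_of_pos (by norm_num : (0 : ℝ) < 1 / 2)]
  have := (Finset.abs_sum_le_sum_abs f Finset.univ).trans (Finset.sum_le_sum fun j _ => h j)
  simp only [Finset.sum_const, Finset.card_univ, Fintype.card_fin, nsmul_eq_mul] at this
  linarith

theorem hasDerivAt_heatFlow {t : ℝ} (ht : 0 < t) (x : EuclideanSpace ℝ (Fin n)) :
    HasDerivAt (fun t => heatFlow μ t x) (1 / 2 * ∑ j, heatFlow₂ μ j j t x) t := by
  obtain ⟨C, hC⟩ := exists_abs_mul_heatKernel_le n ht
  have h := hasDerivAt_kernelAvg (μ := μ)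
    (k := heatKernel) (k' := fun t z => 1 / 2 * ∑ j, heatWeight₂ j j t z * heatKernel t z)
    (Ioo_mem_nhds (mem_Ioo_window ht).1 (mem_Ioo_window ht).2) (fun t => by fun_prop)
    (by fun_prop) (abs_heatKernel_le ht) (fun r hr z => abs_half_sum_le fun j => (hC r hr z).2.1 j j)
    (fun r hr z => hasDerivAt_heatKernel (by linarith [hr.1]) z) x
  refine h.congr_deriv ?_
  unfold kernelAvg
  rw [integral_const_mul, integral_finsetSum]
  · rfl
  · exact fun j _ => integrable_translate (k := fun z => heatWeight₂ j j t z * heatKernel t z)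
      (by fun_prop) (fun z => (hC t (mem_Ioo_window ht) z).2.1 j j) x

theorem hasDerivAt_heatFlow₁ (i : Fin n) {t : ℝ} (ht : 0 < t) (x : EuclideanSpace ℝ (Fin n)) :
    HasDerivAt (fun t => heatFlow₁ μ i t x) (1 / 2 * ∑ j, heatFlow₃ μ i j t x) t := by
  obtain ⟨C, hC⟩ := exists_abs_mul_heatKernel_le n ht
  have h := hasDerivAt_kernelAvg (μ := μ) (k := fun t z => heatWeight₁ i t z * heatKernel t z)
    (k' := fun t z => 1 / 2 * ∑ j, heatWeight₃ i j t z * heatKernel t z)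
    (Ioo_mem_nhds (mem_Ioo_window ht).1 (mem_Ioo_window ht).2) (fun t => by fun_prop)
    (by fun_prop) (fun z => (hC t (mem_Ioo_window ht) z).1 i)
    (fun r hr z => abs_half_sum_le fun j => (hC r hr z).2.2 i j)
    (fun r hr z => hasDerivAt_heatKernel₁ i (by linarith [hr.1]) z) x
  refine h.congr_deriv ?_
  unfold kernelAvg
  rw [integral_const_mul, integral_finsetSum]
  · rfl
  · exact fun j _ => integrable_translate (k := fun z => heatWeight₃ i j t z * heatKernel t z)
      (by fun_prop) (fun z => (hC t (mem_Ioo_window ht) z).2.2 i j) x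

/-- Moments of a kernel weight of cubic growth are controlled by the heat flow at a later time. -/
theorem exists_kernelAvg_pow_le {D s : ℝ} (hD : 1 ≤ D) (hs : 0 < s) :
    ∃ C > 0, ∀ t ∈ Ioo (s / 2) (3 * s / 2), ∀ W : EuclideanSpace ℝ (Fin n) → ℝ,
      HasCubicGrowth D W → ∀ x,
      kernelAvg μ (fun z => W z * heatKernel t z) x ≤ C * heatFlow μ (2 * s) x ∧
      kernelAvg μ (fun z => W z * heatKernel t z) x ^ 2 ≤
        C * heatFlow μ (2 * s) x * heatFlow μ t x ∧
      kernelAvg μ (fun z => W z * heatKernel t z) x ^ 4 ≤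
        C * heatFlow μ (2 * s) x * heatFlow μ t x ^ 3 := by
  obtain ⟨C, hC, h⟩ := exists_abs_pow_mul_heatKernel_le (n := n) hD hs
  refine ⟨C, hC, fun t ht W hW x => ?_⟩
  have ht0 : 0 < t := by linarith [ht.1]
  have hWc := hW.1
  set B := C * heatKernel (2 * s) (0 : EuclideanSpace ℝ (Fin n))
  have hb m (hm : m ≤ 4) z : |W z ^ m * heatKernel t z| ≤ C * heatKernel (2 * s) z := by
    rw [abs_mul, abs_pow, abs_of_pos (heatKernel_pos ht0 z)]
    exact h t ht W hW m hm z
  have hb' m (hm : m ≤ 4) z : |W z ^ m * heatKernel t z| ≤ B :=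
    (hb m hm z).trans (mul_le_mul_of_nonneg_left (heatKernel_le_zero (by positivity) z) hC.le)
  have hs' (z : EuclideanSpace ℝ (Fin n)) : |C * heatKernel (2 * s) z| ≤ B := by
    rw [abs_of_pos (mul_pos hC (heatKernel_pos (by positivity) z))]
    exact mul_le_mul_of_nonneg_left (heatKernel_le_zero (by positivity) z) hC.le
  have hmom m (hm : m ≤ 4) :
      kernelAvg μ (fun z => W z ^ m * heatKernel t z) x ≤ C * heatFlow μ (2 * s) x := by
    refine (kernelAvg_mono (by fun_prop) (by fun_prop) (hb' m hm) hs'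
      (fun z => (le_abs_self _).trans (hb m hm z)) x).trans_eq ?_
    simp only [kernelAvg, heatFlow, integral_const_mul]
  have hp := heatFlow_pos (μ := μ) ht0 x
  have h1 := hmom 1 (by norm_num)
  have h2 := hmom 2 (by norm_num)
  have h4 := hmom 4 le_rfl
  have hb1 := hb' 1 (by norm_num)
  simp only [pow_one] at h1 hb1
  -- Cauchy–Schwarz for `W` and again for `W²`: with `a`, `A`, `A₄` the first, second and fourth
  -- moments, `a² ≤ A p` and `A² ≤ A₄ p`, so `a⁴ ≤ A₄ p³`.
  have j1 := sq_kernelAvg_mul_le (μ := μ) hWc (continuous_heatKernel t) (abs_heatKernel_le ht0)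
    hb1 (hb' 2 (by norm_num)) (heatKernel_pos ht0) x
  have j2 := sq_kernelAvg_mul_le (μ := μ) (W := fun z => W z ^ 2) (hWc.pow 2) (continuous_heatKernel t)
    (abs_heatKernel_le ht0) (hb' 2 (by norm_num))
    (fun z => by rw [← pow_mul]; exact hb' 4 le_rfl z) (heatKernel_pos ht0) x
  simp only [← pow_mul] at j2
  change _ ≤ _ * heatFlow μ t x at j1 j2
  set a := kernelAvg μ (fun z => W z * heatKernel t z) x
  set p := heatFlow μ t x
  set A := kernelAvg μ (fun z => W z ^ 2 * heatKernel t z) x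
  refine ⟨h1, j1.trans (mul_le_mul_of_nonneg_right h2 hp.le), ?_⟩
  calc a ^ 4 = (a ^ 2) ^ 2 := by ring
    _ ≤ (A * p) ^ 2 := by gcongr
    _ = A ^ 2 * p ^ 2 := by ring
    _ ≤ (kernelAvg μ (fun z => W z ^ (2 * 2) * heatKernel t z) x * p) * p ^ 2 := by gcongr
    _ ≤ (C * heatFlow μ (2 * s) x * p) * p ^ 2 := by gcongr
    _ = _ := by ring

/-- The source of all domination: `M = C p_{2s}(x)` is integrable in `x` and does not depend on `t`
in the window, and the powers of `p_t` on the right cancel the denominators that occur later. -/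
theorem exists_heatFlow_bounds (μ : Measure (EuclideanSpace ℝ (Fin n))) [IsProbabilityMeasure μ]
    {s : ℝ} (hs : 0 < s) :
    ∃ C > 0, ∀ t ∈ Ioo (s / 2) (3 * s / 2), ∀ x,
      heatFlow μ t x ≤ C * heatFlow μ (2 * s) x ∧
      (∀ i, heatFlow₁ μ i t x ^ 2 ≤ C * heatFlow μ (2 * s) x * heatFlow μ t x) ∧
      (∀ i, heatFlow₁ μ i t x ^ 4 ≤ C * heatFlow μ (2 * s) x * heatFlow μ t x ^ 3) ∧
      (∀ i j, heatFlow₂ μ i j t x ^ 2 ≤ C * heatFlow μ (2 * s) x * heatFlow μ t x) ∧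
      (∀ i j, heatFlow₃ μ i j t x ^ 2 ≤ C * heatFlow μ (2 * s) x * heatFlow μ t x) := by
  obtain ⟨D, hD, hW⟩ := exists_hasCubicGrowth n hs
  obtain ⟨C, hC, h⟩ := exists_kernelAvg_pow_le (μ := μ) hD hs
  refine ⟨C, hC, fun t ht x => ?_⟩
  obtain ⟨h0, h1, h2, h3⟩ := hW t ht.1
  have := (h t ht _ h0 x).1
  simp only [one_mul] at this
  exact ⟨this, fun i => (h t ht _ (h1 i) x).2.1, fun i => (h t ht _ (h1 i) x).2.2,
    fun i j => (h t ht _ (h2 i j) x).2.1, fun i j => (h t ht _ (h3 i j) x).2.1⟩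

/-- The kernel bound and Jensen for `r ↦ r⁴` give `c p_{2s}⁴ ≤ p_t`; together with `p_t ≤ C p_{2s}`
this traps `log p_t` between `log c + 4 log p_{2s}` and `log C + log p_{2s}`. -/
theorem exists_abs_log_heatFlow_le (μ : Measure (EuclideanSpace ℝ (Fin n)))
    [IsProbabilityMeasure μ] {s : ℝ} (hs : 0 < s) :
    ∃ C > 0, ∀ t ∈ Ioo (s / 2) (3 * s / 2), ∀ x,
      |Real.log (heatFlow μ t x)| ≤ C * (1 + |Real.log (heatFlow μ (2 * s) x)|) := by
  obtain ⟨C, hC, h⟩ := exists_heatFlow_bounds μ hs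
  obtain ⟨c, hc, hl⟩ := exists_mul_heatKernel_pow_le (n := n) hs
  refine ⟨|Real.log C| + |Real.log c| + 4, by positivity, fun t ht x => ?_⟩
  have ht0 : 0 < t := by linarith [ht.1]
  have hp := heatFlow_pos (μ := μ) ht0 x
  have hq := heatFlow_pos (μ := μ) (show 0 < 2 * s by positivity) x
  have hlow : c * heatFlow μ (2 * s) x ^ 4 ≤ heatFlow μ t x := by
    have hb (z : EuclideanSpace ℝ (Fin n)) : |heatKernel (2 * s) z ^ 4| ≤
        heatKernel (2 * s) (0 : EuclideanSpace ℝ (Fin n)) ^ 4 := by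
      rw [abs_pow]
      exact pow_le_pow_left₀ (abs_nonneg _) (abs_heatKernel_le (by positivity) z) 4
    have j := ConvexOn.map_integral_le (μ := μ) (f := fun y => heatKernel (2 * s) (x - y))
      (g := fun r : ℝ => r ^ 4) (s := univ) (Even.convexOn_pow (by decide)) (by fun_prop)
      isClosed_univ (by simp) (integrable_translate (by fun_prop) (abs_heatKernel_le (by positivity)) x)
      (integrable_translate (k := fun z => heatKernel (2 * s) z ^ 4) (by fun_prop) hb x)
    have j2 := kernelAvg_mono (μ := μ) (k := fun z => c * heatKernel (2 * s) z ^ 4)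
      (l := heatKernel t) (by fun_prop) (by fun_prop)
      (C := c * heatKernel (2 * s) (0 : EuclideanSpace ℝ (Fin n)) ^ 4)
      (fun z => by rw [abs_mul, abs_of_pos hc]; exact mul_le_mul_of_nonneg_left (hb z) hc.le)
      (abs_heatKernel_le ht0) (hl t ht) x
    refine le_trans ?_ j2
    rw [kernelAvg, integral_const_mul]
    exact mul_le_mul_of_nonneg_left j hc.le
  have h1 := Real.log_le_log (by positivity) hlow
  have h2 := Real.log_le_log hp (h t ht x).1
  rw [Real.log_mul hc.ne' (by positivity), Real.log_pow] at h1
  rw [Real.log_mul hC.ne' hq.ne'] at h2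
  push_cast at h1
  set L := Real.log (heatFlow μ (2 * s) x)
  have a1 := neg_abs_le (Real.log c)
  have a2 := le_abs_self (Real.log C)
  have a3 := neg_abs_le L
  have a4 := le_abs_self L
  have b1 := mul_nonneg (abs_nonneg (Real.log C)) (abs_nonneg L)
  have b2 := mul_nonneg (abs_nonneg (Real.log c)) (abs_nonneg L)
  have b3 := abs_nonneg (Real.log c)
  have b4 := abs_nonneg (Real.log C)
  have b5 := abs_nonneg L
  rw [abs_le]
  constructor <;> nlinarith

end HeatFlow

/-! ### The density of the Gaussian perturbation -/

section Gaussian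

variable {n : ℕ}

theorem integral_heatKernel {t : ℝ} (ht : 0 < t) :
    ∫ z : EuclideanSpace ℝ (Fin n), heatKernel t z = 1 := by
  unfold heatKernel
  rw [integral_const_mul]
  have h := GaussianFourier.integral_rexp_neg_mul_sq_norm (V := EuclideanSpace ℝ (Fin n))
    (b := 1 / (2 * t)) (by positivity)
  have e : ∀ z : EuclideanSpace ℝ (Fin n),
      Real.exp (-‖z‖ ^ 2 / (2 * t)) = Real.exp (-(1 / (2 * t)) * ‖z‖ ^ 2) := fun z => by
    congr 1; ring
  simp_rw [e]
  rw [h, finrank_euclideanSpace_fin, show Real.pi / (1 / (2 * t)) = 2 * Real.pi * t by field_simp,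
    ← Real.rpow_add (by positivity)]
  simp [neg_div]

theorem integrable_heatKernel {t : ℝ} (ht : 0 < t) :
    Integrable (heatKernel t : EuclideanSpace ℝ (Fin n) → ℝ) :=
  Integrable.of_integral_ne_zero (by rw [integral_heatKernel ht]; exact one_ne_zero)

/-- Serves to identify the multivariate Gaussian with its density, since characteristic functions
determine finite measures. -/
theorem charFun_withDensity_heatKernel {t : ℝ} (ht : 0 < t) (ξ : EuclideanSpace ℝ (Fin n)) :
    charFun (volume.withDensity fun z => ENNReal.ofReal (heatKernel t z)) ξ
      = Complex.exp (-(t * ‖ξ‖ ^ 2 / 2 : ℝ)) := by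
  rw [charFun_apply, integral_withDensity_eq_integral_toReal_smul
    (by have := (continuous_heatKernel (n := n) t).measurable; fun_prop) (by simp)]
  have e (z : EuclideanSpace ℝ (Fin n)) :
      (ENNReal.ofReal (heatKernel t z)).toReal • Complex.exp (inner ℝ z ξ * Complex.I)
        = ((2 * Real.pi * t) ^ (-(n : ℝ) / 2) : ℝ) *
          Complex.exp (-((1 / (2 * t) : ℝ) : ℂ) * ‖z‖ ^ 2 + Complex.I * inner ℝ ξ z) := by
    rw [ENNReal.toReal_ofReal (heatKernel_pos ht z).le, heatKernel, Complex.exp_add,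
      Complex.real_smul, Complex.ofReal_mul, Complex.ofReal_exp, mul_assoc, real_inner_comm ξ z,
      mul_comm Complex.I]
    congr 3
    push_cast
    ring
  simp_rw [e]
  rw [integral_const_mul, GaussianFourier.integral_cexp_neg_mul_sq_norm_add
    (by rw [Complex.ofReal_re]; positivity), finrank_euclideanSpace_fin]
  have e2 : ((Real.pi : ℂ) / ((1 / (2 * t) : ℝ) : ℂ)) ^ ((n : ℂ) / 2)
      = ((2 * Real.pi * t) ^ ((n : ℝ) / 2) : ℝ) := by
    rw [Complex.ofReal_cpow (by positivity)]
    push_cast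
    congr 1
    have : (t : ℂ) ≠ 0 := by exact_mod_cast ht.ne'
    field_simp
  rw [e2, ← mul_assoc, ← Complex.ofReal_mul, ← Real.rpow_add (by positivity)]
  have h0 : -(n : ℝ) / 2 + n / 2 = 0 := by ring
  rw [h0, Real.rpow_zero, Complex.ofReal_one, one_mul]
  congr 1
  have : (t : ℂ) ≠ 0 := by exact_mod_cast ht.ne'
  push_cast
  rw [Complex.I_sq]
  field_simp
  ring

theorem isProbabilityMeasure_withDensity_heatKernel {t : ℝ} (ht : 0 < t) :
    IsProbabilityMeasure (volume.withDensity fun z : EuclideanSpace ℝ (Fin n) =>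
      ENNReal.ofReal (heatKernel t z)) := by
  refine ⟨?_⟩
  rw [withDensity_apply _ MeasurableSet.univ, Measure.restrict_univ,
    ← ofReal_integral_eq_lintegral_ofReal (integrable_heatKernel ht)
      (ae_of_all _ fun z => (heatKernel_pos ht z).le), integral_heatKernel ht, ENNReal.ofReal_one]

theorem multivariateGaussian_eq_withDensity_heatKernel {t : ℝ} (ht : 0 < t) :
    multivariateGaussian 0 (t • (1 : Matrix (Fin n) (Fin n) ℝ))
      = volume.withDensity fun z => ENNReal.ofReal (heatKernel t z) := by
  have := isProbabilityMeasure_withDensity_heatKernel (n := n) ht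
  apply Measure.ext_of_charFun
  ext ξ
  rw [charFun_withDensity_heatKernel ht, charFun_multivariateGaussian
    (Matrix.PosSemidef.one.smul ht.le)]
  have h : dotProduct ξ (Matrix.mulVec (t • (1 : Matrix (Fin n) (Fin n) ℝ)) ξ) = t * ‖ξ‖ ^ 2 := by
    rw [Matrix.smul_mulVec, Matrix.one_mulVec, dotProduct_smul, EuclideanSpace.real_norm_sq_eq,
      smul_eq_mul]
    simp [dotProduct, pow_two]
  rw [h]
  simp

theorem conv_withDensity_heatKernel (μ : Measure (EuclideanSpace ℝ (Fin n)))
    [IsProbabilityMeasure μ] {t : ℝ} (ht : 0 < t) :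
    μ.conv (volume.withDensity fun z => ENNReal.ofReal (heatKernel t z))
      = volume.withDensity fun x => ENNReal.ofReal (heatFlow μ t x) := by
  have := isProbabilityMeasure_withDensity_heatKernel (n := n) ht
  have hk := (continuous_heatKernel (n := n) t).measurable
  refine Measure.ext_of_lintegral _ fun φ hφ => ?_
  rw [Measure.lintegral_conv hφ, lintegral_withDensity_eq_lintegral_mul _ (by fun_prop) hφ]
  have h1 (y : EuclideanSpace ℝ (Fin n)) :
      ∫⁻ z, φ (y + z) ∂(volume.withDensity fun z => ENNReal.ofReal (heatKernel t z))
        = ∫⁻ x, ENNReal.ofReal (heatKernel t (x - y)) * φ x := by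
    rw [lintegral_withDensity_eq_lintegral_mul _ (by fun_prop) (by fun_prop),
      ← lintegral_add_left_eq_self (fun x => ENNReal.ofReal (heatKernel t (x - y)) * φ x) y]
    simp
  simp_rw [h1]
  rw [lintegral_lintegral_swap (by fun_prop)]
  refine lintegral_congr fun x => ?_
  rw [lintegral_mul_const _ (by fun_prop), Pi.mul_apply, heatFlow, kernelAvg,
    ofReal_integral_eq_lintegral_ofReal (integrable_translate (by fun_prop) (abs_heatKernel_le ht) x)
      (ae_of_all _ fun y => (heatKernel_pos ht _).le)]

theorem integrable_heatFlow (μ : Measure (EuclideanSpace ℝ (Fin n))) [IsProbabilityMeasure μ]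
    {t : ℝ} (ht : 0 < t) : Integrable (heatFlow μ t) := by
  have := isProbabilityMeasure_withDensity_heatKernel (n := n) ht
  have h : ∫⁻ x, ENNReal.ofReal (heatFlow μ t x) = 1 := by
    rw [← setLIntegral_univ, ← withDensity_apply _ MeasurableSet.univ,
      ← conv_withDensity_heatKernel μ ht, measure_univ]
  refine (lintegral_ofReal_ne_top_iff_integrable (by fun_prop)
    (ae_of_all _ fun x => (heatFlow_pos ht x).le)).1 ?_
  rw [h]
  exact ENNReal.one_ne_top

theorem integral_heatFlow (μ : Measure (EuclideanSpace ℝ (Fin n))) [IsProbabilityMeasure μ]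
    {t : ℝ} (ht : 0 < t) : ∫ x, heatFlow μ t x = 1 := by
  have := isProbabilityMeasure_withDensity_heatKernel (n := n) ht
  have h : ∫⁻ x, ENNReal.ofReal (heatFlow μ t x) = 1 := by
    rw [← setLIntegral_univ, ← withDensity_apply _ MeasurableSet.univ,
      ← conv_withDensity_heatKernel μ ht, measure_univ]
  rw [integral_eq_lintegral_of_nonneg_ae (ae_of_all _ fun x => (heatFlow_pos ht x).le)
    (by fun_prop), h, ENNReal.toReal_one]

theorem pdf_add_gaussian_ae_eq {Ω : Type*} [MeasurableSpace Ω] {P : Measure Ω}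
    [IsProbabilityMeasure P] {X Y : Ω → EuclideanSpace ℝ (Fin n)} (hX : AEMeasurable X P) {t : ℝ}
    (ht : 0 < t) (hY : HasLaw Y (multivariateGaussian 0 (t • (1 : Matrix (Fin n) (Fin n) ℝ))) P)
    (h : IndepFun X Y P) :
    (fun x => (pdf (X + Y) P volume x).toReal) =ᵐ[volume] heatFlow (P.map X) t := by
  have := Measure.isProbabilityMeasure_map hX
  have hm : P.map (X + Y) =
      volume.withDensity fun x => ENNReal.ofReal (heatFlow (P.map X) t x) := by
    rw [h.map_add_eq_map_conv_map₀ hX hY.aemeasurable, hY.map_eq,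
      multivariateGaussian_eq_withDensity_heatKernel ht, conv_withDensity_heatKernel _ ht]
  have hd : pdf (X + Y) P volume =ᵐ[volume]
      fun x => ENNReal.ofReal (heatFlow (P.map X) t x) := by
    rw [pdf_def, hm]
    exact Measure.rnDeriv_withDensity _ (by fun_prop)
  filter_upwards [hd] with x hx
  rw [hx, ENNReal.toReal_ofReal (heatFlow_pos ht x).le]

end Gaussian

/-! ### Fisher information and algebraic bounds on the integrands -/

noncomputable section

/-- The Fisher information `∫ |∇p|² / p` of `μ ∗ N(0, t I)`. -/
def fisherInfo {n : ℕ} (μ : Measure (EuclideanSpace ℝ (Fin n))) (t : ℝ) : ℝ :=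
  ∑ i, ∫ x, heatFlow₁ μ i t x ^ 2 / heatFlow μ t x

/-- The function `p ∂ᵢ∂ⱼ log p`, with `p` the density of `μ ∗ N(0, t I)`. -/
def heatHessLog {n : ℕ} (μ : Measure (EuclideanSpace ℝ (Fin n))) (i j : Fin n) (t : ℝ)
    (x : EuclideanSpace ℝ (Fin n)) : ℝ :=
  heatFlow₂ μ i j t x - heatFlow₁ μ i t x * heatFlow₁ μ j t x / heatFlow μ t x

/-- The integral `∫ p |∇² log p|²`, with `p` the density of `μ ∗ N(0, t I)`. -/
def hessianInfo {n : ℕ} (μ : Measure (EuclideanSpace ℝ (Fin n))) (t : ℝ) : ℝ :=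
  ∑ i, ∑ j, ∫ x, heatHessLog μ i j t x ^ 2 / heatFlow μ t x

end

section Estimates

theorem abs_le_of_sq_le_mul {a p M : ℝ} (hp : 0 < p) (hpM : p ≤ M) (h : a ^ 2 ≤ M * p) :
    |a| ≤ M := by
  apply abs_le_of_sq_le_sq _ (hp.le.trans hpM)
  nlinarith

variable {a c u v w p M : ℝ}

/-- In this family `a, c, v, u, w` stand for `∂ᵢp, ∂ⱼp, ∂ⱼ∂ᵢp, ∂ⱼ∂ⱼp, ∂ⱼ∂ⱼ∂ᵢp` and `M` for `C
p_{2s}`. Here the expression is `∂ⱼ(a²/p)`. Dividing each variable by `p` makes it `p` times a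
polynomial, and AM–GM reduces that to the squares and fourth powers controlled by the hypotheses. -/
theorem abs_fisherGrad_le (hp : 0 < p) (ha : a ^ 2 ≤ M * p) (ha4 : a ^ 4 ≤ M * p ^ 3)
    (hc : c ^ 2 ≤ M * p) (hv : v ^ 2 ≤ M * p) :
    |2 * a * v / p - a ^ 2 * c / p ^ 2| ≤ 3 * M := by
  obtain ⟨r, rfl⟩ : ∃ r, a = r * p := ⟨a / p, by field_simp⟩
  obtain ⟨q, rfl⟩ : ∃ r, c = r * p := ⟨c / p, by field_simp⟩
  obtain ⟨y, rfl⟩ : ∃ r, v = r * p := ⟨v / p, by field_simp⟩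
  have h1 : p * r ^ 2 ≤ M := le_of_mul_le_mul_right (by linarith) hp
  have h2 : p * r ^ 4 ≤ M := le_of_mul_le_mul_right (by linarith) (pow_pos hp 3)
  have h3 : p * q ^ 2 ≤ M := le_of_mul_le_mul_right (by linarith) hp
  have h4 : p * y ^ 2 ≤ M := le_of_mul_le_mul_right (by linarith) hp
  have e : 2 * (r * p) * (y * p) / p - (r * p) ^ 2 * (q * p) / p ^ 2
      = p * (2 * r * y - r ^ 2 * q) := by field_simp
  have hb : |2 * r * y - r ^ 2 * q| ≤ r ^ 2 + y ^ 2 + (r ^ 4 + q ^ 2) / 2 := by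
    rw [abs_le]
    constructor <;> linarith [sq_nonneg (r + y), sq_nonneg (r - y), sq_nonneg (r ^ 2 + q),
      sq_nonneg (r ^ 2 - q)]
  rw [e, abs_mul, abs_of_pos hp]
  calc _ ≤ p * (r ^ 2 + y ^ 2 + (r ^ 4 + q ^ 2) / 2) := by gcongr
    _ ≤ _ := by linarith

/-- The same method for `∂ⱼ∂ⱼ(a²/p)`. -/
theorem abs_fisherLaplacian_le (hp : 0 < p) (ha : a ^ 2 ≤ M * p) (ha4 : a ^ 4 ≤ M * p ^ 3)
    (hc4 : c ^ 4 ≤ M * p ^ 3) (hu : u ^ 2 ≤ M * p) (hv : v ^ 2 ≤ M * p) (hw : w ^ 2 ≤ M * p) :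
    |2 * v ^ 2 / p + 2 * a * w / p - 4 * a * c * v / p ^ 2 - a ^ 2 * u / p ^ 2
      + 2 * a ^ 2 * c ^ 2 / p ^ 3| ≤ 11 * M := by
  obtain ⟨r, rfl⟩ : ∃ r, a = r * p := ⟨a / p, by field_simp⟩
  obtain ⟨q, rfl⟩ : ∃ r, c = r * p := ⟨c / p, by field_simp⟩
  obtain ⟨y, rfl⟩ : ∃ r, v = r * p := ⟨v / p, by field_simp⟩
  obtain ⟨l, rfl⟩ : ∃ r, u = r * p := ⟨u / p, by field_simp⟩
  obtain ⟨k, rfl⟩ : ∃ r, w = r * p := ⟨w / p, by field_simp⟩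
  have h1 : p * r ^ 2 ≤ M := le_of_mul_le_mul_right (by linarith) hp
  have h2 : p * r ^ 4 ≤ M := le_of_mul_le_mul_right (by linarith) (pow_pos hp 3)
  have h3 : p * q ^ 4 ≤ M := le_of_mul_le_mul_right (by linarith) (pow_pos hp 3)
  have h4 : p * y ^ 2 ≤ M := le_of_mul_le_mul_right (by linarith) hp
  have h5 : p * l ^ 2 ≤ M := le_of_mul_le_mul_right (by linarith) hp
  have h6 : p * k ^ 2 ≤ M := le_of_mul_le_mul_right (by linarith) hp
  have e : 2 * (y * p) ^ 2 / p + 2 * (r * p) * (k * p) / p - 4 * (r * p) * (q * p) * (y * p) / p ^ 2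
      - (r * p) ^ 2 * (l * p) / p ^ 2 + 2 * (r * p) ^ 2 * (q * p) ^ 2 / p ^ 3
      = p * (2 * y ^ 2 + 2 * r * k - 4 * r * q * y - r ^ 2 * l + 2 * r ^ 2 * q ^ 2) := by field_simp
  have hb : |2 * y ^ 2 + 2 * r * k - 4 * r * q * y - r ^ 2 * l + 2 * r ^ 2 * q ^ 2| ≤
      4 * y ^ 2 + r ^ 2 + k ^ 2 + (r ^ 4 + l ^ 2) / 2 + 2 * (r ^ 4 + q ^ 4) := by
    rw [abs_le]
    constructor <;> linarith [sq_nonneg (r + k), sq_nonneg (r - k), sq_nonneg (r ^ 2 + l),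
      sq_nonneg (r ^ 2 - l), sq_nonneg (r ^ 2 - q ^ 2), sq_nonneg (r * q + y),
      sq_nonneg (r * q - y), sq_nonneg y, sq_nonneg (r * q)]
  rw [e, abs_mul, abs_of_pos hp]
  calc _ ≤ p * (4 * y ^ 2 + r ^ 2 + k ^ 2 + (r ^ 4 + l ^ 2) / 2 + 2 * (r ^ 4 + q ^ 4)) := by gcongr
    _ ≤ _ := by linarith

/-- The same method for the `j`-th summand of `∂ₜ(a²/p)`, as given by the heat equation. -/
theorem abs_fisherTime_le (hp : 0 < p) (ha : a ^ 2 ≤ M * p) (ha4 : a ^ 4 ≤ M * p ^ 3)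
    (hu : u ^ 2 ≤ M * p) (hw : w ^ 2 ≤ M * p) :
    |a * w / p - 1 / 2 * (a ^ 2 * u / p ^ 2)| ≤ 2 * M := by
  obtain ⟨r, rfl⟩ : ∃ r, a = r * p := ⟨a / p, by field_simp⟩
  obtain ⟨l, rfl⟩ : ∃ r, u = r * p := ⟨u / p, by field_simp⟩
  obtain ⟨k, rfl⟩ : ∃ r, w = r * p := ⟨w / p, by field_simp⟩
  have h1 : p * r ^ 2 ≤ M := le_of_mul_le_mul_right (by linarith) hp
  have h2 : p * r ^ 4 ≤ M := le_of_mul_le_mul_right (by linarith) (pow_pos hp 3)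
  have h5 : p * l ^ 2 ≤ M := le_of_mul_le_mul_right (by linarith) hp
  have h6 : p * k ^ 2 ≤ M := le_of_mul_le_mul_right (by linarith) hp
  have e : (r * p) * (k * p) / p - 1 / 2 * ((r * p) ^ 2 * (l * p) / p ^ 2)
      = p * (r * k - r ^ 2 * l / 2) := by field_simp
  have hb : |r * k - r ^ 2 * l / 2| ≤ (r ^ 2 + k ^ 2) / 2 + (r ^ 4 + l ^ 2) / 4 := by
    rw [abs_le]
    constructor <;> linarith [sq_nonneg (r + k), sq_nonneg (r - k), sq_nonneg (r ^ 2 + l),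
      sq_nonneg (r ^ 2 - l)]
  rw [e, abs_mul, abs_of_pos hp]
  calc _ ≤ p * ((r ^ 2 + k ^ 2) / 2 + (r ^ 4 + l ^ 2) / 4) := by gcongr
    _ ≤ _ := by nlinarith [mul_nonneg hp.le (sq_nonneg r)]

theorem abs_sq_hessLog_div_le (hp : 0 < p) (ha4 : a ^ 4 ≤ M * p ^ 3) (hc4 : c ^ 4 ≤ M * p ^ 3)
    (hv : v ^ 2 ≤ M * p) : |(v - a * c / p) ^ 2 / p| ≤ 4 * M := by
  obtain ⟨r, rfl⟩ : ∃ r, a = r * p := ⟨a / p, by field_simp⟩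
  obtain ⟨q, rfl⟩ : ∃ r, c = r * p := ⟨c / p, by field_simp⟩
  obtain ⟨y, rfl⟩ : ∃ r, v = r * p := ⟨v / p, by field_simp⟩
  have h2 : p * r ^ 4 ≤ M := le_of_mul_le_mul_right (by linarith) (pow_pos hp 3)
  have h3 : p * q ^ 4 ≤ M := le_of_mul_le_mul_right (by linarith) (pow_pos hp 3)
  have h4 : p * y ^ 2 ≤ M := le_of_mul_le_mul_right (by linarith) hp
  have e : (y * p - r * p * (q * p) / p) ^ 2 / p = p * (y - r * q) ^ 2 := by field_simp
  have hb : (y - r * q) ^ 2 ≤ 2 * y ^ 2 + (r ^ 4 + q ^ 4) := by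
    linarith [sq_nonneg (y + r * q), sq_nonneg (r ^ 2 - q ^ 2)]
  rw [e, abs_of_nonneg (by positivity)]
  calc _ ≤ p * (2 * y ^ 2 + (r ^ 4 + q ^ 4)) := by gcongr
    _ ≤ _ := by linarith

theorem hasDerivAt_fisherGrad {a c v p : ℝ → ℝ} {s u w : ℝ} (hp0 : p s ≠ 0)
    (ha : HasDerivAt a (v s) s) (hc : HasDerivAt c u s) (hv : HasDerivAt v w s)
    (hp : HasDerivAt p (c s) s) :
    HasDerivAt (fun s => 2 * a s * v s / p s - a s ^ 2 * c s / p s ^ 2)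
      (2 * v s ^ 2 / p s + 2 * a s * w / p s - 4 * a s * c s * v s / p s ^ 2
        - a s ^ 2 * u / p s ^ 2 + 2 * a s ^ 2 * c s ^ 2 / p s ^ 3) s := by
  have h := (((ha.const_mul 2).fun_mul hv).fun_div hp hp0).fun_sub
    (((ha.fun_pow 2).fun_mul hc).fun_div (hp.fun_pow 2) (pow_ne_zero 2 hp0))
  refine h.congr_deriv ?_
  field_simp
  ring

end Estimates

/-! ### Vanishing of divergences under the integral -/

section Integrals

variable {n : ℕ}

/-- Integration by parts against the constant 1. -/
theorem integral_eq_zero_of_hasLineDerivAt {G G' : EuclideanSpace ℝ (Fin n) → ℝ}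
    {v : EuclideanSpace ℝ (Fin n)} (hG : Integrable G) (hG' : Integrable G')
    (h : ∀ x, HasLineDerivAt ℝ G (G' x) x v) : ∫ x, G' x = 0 := by
  have := integral_bilinear_hasLineDerivAt_right_eq_neg_left_of_integrable
    (μ := (volume : Measure (EuclideanSpace ℝ (Fin n)))) (f := fun _ => (1 : ℝ)) (f' := fun _ => 0)
    (g := G) (g' := G') (v := v) (B := ContinuousLinearMap.mul ℝ ℝ) (by simp) (by simpa using hG')
    (by simpa using hG) (fun _ _ => hasDerivAt_const (0 : ℝ) (1 : ℝ)) (fun x _ => h x)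
  simpa using this

/-- Differentiation under the integral sign, modulo a divergence. -/
theorem hasDerivAt_integral_of_divergence {F F' : ℝ → EuclideanSpace ℝ (Fin n) → ℝ}
    {R bound : EuclideanSpace ℝ (Fin n) → ℝ} {G G' : Fin n → EuclideanSpace ℝ (Fin n) → ℝ}
    {t : ℝ} {S : Set ℝ} (hS : S ∈ nhds t) (hFm : ∀ r, AEStronglyMeasurable (F r) volume)
    (hFi : Integrable (F t)) (hF'm : AEStronglyMeasurable (F' t) volume)
    (hF : ∀ r ∈ S, ∀ x, HasDerivAt (fun r => F r x) (F' r x) r)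
    (hb : ∀ r ∈ S, ∀ x, |F' r x| ≤ bound x) (hbi : Integrable bound)
    (hGi : ∀ j, Integrable (G j)) (hG'i : ∀ j, Integrable (G' j))
    (hG : ∀ j x, HasLineDerivAt ℝ (G j) (G' j x) x (EuclideanSpace.single j 1))
    (hR : ∀ x, F' t x = 1 / 2 * ∑ j, G' j x + R x) :
    HasDerivAt (fun r => ∫ x, F r x) (∫ x, R x) t := by
  obtain ⟨hi, hd⟩ := hasDerivAt_integral_of_dominated_loc_of_deriv_le hS
    (Filter.Eventually.of_forall hFm) hFi hF'm (ae_of_all _ fun x r hr => hb r hr x) hbi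
    (ae_of_all _ fun x r hr => hF r hr x)
  refine hd.congr_deriv ?_
  have hs : Integrable (fun x => 1 / 2 * ∑ j, G' j x) :=
    (integrable_finsetSum _ fun j _ => hG'i j).const_mul _
  have e : R = fun x => F' t x - 1 / 2 * ∑ j, G' j x := by
    ext x; rw [hR x]; ring
  rw [e, integral_sub hi hs, integral_const_mul, integral_finsetSum _ fun j _ => hG'i j,
    Finset.sum_eq_zero fun j _ => integral_eq_zero_of_hasLineDerivAt (hGi j) (hG'i j) (hG j)]
  ring

end Integrals

/-! ### Derivatives of entropy and Fisher information -/

section Derivatives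

variable {n : ℕ} {μ : Measure (EuclideanSpace ℝ (Fin n))} [IsProbabilityMeasure μ]

theorem integrable_of_abs_le_heatFlow {f : EuclideanSpace ℝ (Fin n) → ℝ} (hf : Measurable f)
    {C s : ℝ} (hs : 0 < s) (h : ∀ x, |f x| ≤ C * heatFlow μ s x) : Integrable f :=
  ((integrable_heatFlow μ hs).const_mul C).mono' hf.aestronglyMeasurable (ae_of_all _ h)

theorem integrable_heatFlow₁ (i : Fin n) {t : ℝ} (ht : 0 < t) : Integrable (heatFlow₁ μ i t) := by
  obtain ⟨C, -, h⟩ := exists_heatFlow_bounds μ ht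
  refine integrable_of_abs_le_heatFlow (μ := μ) (C := C) (by fun_prop)
    (by positivity : 0 < 2 * t) fun x => ?_
  obtain ⟨h0, h1, -⟩ := h t (mem_Ioo_window ht) x
  exact abs_le_of_sq_le_mul (heatFlow_pos ht x) h0 (h1 i)

theorem integrable_heatFlow₂ (i j : Fin n) {t : ℝ} (ht : 0 < t) :
    Integrable (heatFlow₂ μ i j t) := by
  obtain ⟨C, -, h⟩ := exists_heatFlow_bounds μ ht
  refine integrable_of_abs_le_heatFlow (μ := μ) (C := C) (by fun_prop)
    (by positivity : 0 < 2 * t) fun x => ?_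
  obtain ⟨h0, -, -, h2, -⟩ := h t (mem_Ioo_window ht) x
  exact abs_le_of_sq_le_mul (heatFlow_pos ht x) h0 (h2 i j)

theorem integral_heatFlow₂ (i j : Fin n) {t : ℝ} (ht : 0 < t) : ∫ x, heatFlow₂ μ i j t x = 0 :=
  integral_eq_zero_of_hasLineDerivAt (integrable_heatFlow₁ i ht) (integrable_heatFlow₂ i j ht)
    (hasLineDerivAt_heatFlow₁ i j ht)

theorem integrable_fisher (i : Fin n) {t : ℝ} (ht : 0 < t) :
    Integrable fun x => heatFlow₁ μ i t x ^ 2 / heatFlow μ t x := by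
  obtain ⟨C, -, h⟩ := exists_heatFlow_bounds μ ht
  refine integrable_of_abs_le_heatFlow (μ := μ) (C := C) (by fun_prop)
    (by positivity : 0 < 2 * t) fun x => ?_
  have hp := heatFlow_pos (μ := μ) ht x
  rw [abs_of_nonneg (by positivity), div_le_iff₀ hp]
  exact (h t (mem_Ioo_window ht) x).2.1 i

theorem integrable_sq_heatHessLog (i j : Fin n) {t : ℝ} (ht : 0 < t) :
    Integrable fun x => heatHessLog μ i j t x ^ 2 / heatFlow μ t x := by
  obtain ⟨C, -, h⟩ := exists_heatFlow_bounds μ ht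
  unfold heatHessLog
  refine integrable_of_abs_le_heatFlow (μ := μ) (C := 4 * C) (by fun_prop)
    (by positivity : 0 < 2 * t) fun x => ?_
  obtain ⟨-, -, h4, h2, -⟩ := h t (mem_Ioo_window ht) x
  exact (abs_sq_hessLog_div_le (heatFlow_pos ht x) (h4 i) (h4 j) (h2 i j)).trans_eq (by ring)

/-- With `G j = ∂ⱼ((∂ᵢp)²/p)`, the difference `∂ₜ((∂ᵢp)²/p) - ½ Σⱼ ∂ⱼ(G j)` is exactly minus a sum
of squares, so no further integration by parts is needed. -/
theorem hasDerivAt_fisher (i : Fin n) {t : ℝ} (ht : 0 < t) :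
    HasDerivAt (fun t => ∫ x, heatFlow₁ μ i t x ^ 2 / heatFlow μ t x)
      (-∑ j, ∫ x, heatHessLog μ i j t x ^ 2 / heatFlow μ t x) t := by
  obtain ⟨C, hC, h⟩ := exists_heatFlow_bounds μ ht
  have hw := mem_Ioo_window ht
  have hmain := hasDerivAt_integral_of_divergence (t := t)
    (F := fun t x => heatFlow₁ μ i t x ^ 2 / heatFlow μ t x)
    (F' := fun t x => ∑ j, (heatFlow₁ μ i t x * heatFlow₃ μ i j t x / heatFlow μ t x
      - 1 / 2 * (heatFlow₁ μ i t x ^ 2 * heatFlow₂ μ j j t x / heatFlow μ t x ^ 2)))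
    (R := fun x => -∑ j, heatHessLog μ i j t x ^ 2 / heatFlow μ t x)
    (bound := fun x => n * (2 * (C * heatFlow μ (2 * t) x)))
    (G := fun j x => 2 * heatFlow₁ μ i t x * heatFlow₂ μ i j t x / heatFlow μ t x
      - heatFlow₁ μ i t x ^ 2 * heatFlow₁ μ j t x / heatFlow μ t x ^ 2)
    (G' := fun j x => 2 * heatFlow₂ μ i j t x ^ 2 / heatFlow μ t x
      + 2 * heatFlow₁ μ i t x * heatFlow₃ μ i j t x / heatFlow μ t x
      - 4 * heatFlow₁ μ i t x * heatFlow₁ μ j t x * heatFlow₂ μ i j t x / heatFlow μ t x ^ 2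
      - heatFlow₁ μ i t x ^ 2 * heatFlow₂ μ j j t x / heatFlow μ t x ^ 2
      + 2 * heatFlow₁ μ i t x ^ 2 * heatFlow₁ μ j t x ^ 2 / heatFlow μ t x ^ 3)
    (Ioo_mem_nhds hw.1 hw.2) (fun r => Measurable.aestronglyMeasurable (by fun_prop)) (integrable_fisher i ht)
    (Measurable.aestronglyMeasurable (by fun_prop))
    ?_ ?_ ?_ ?_ ?_ ?_ ?_
  · refine hmain.congr_deriv ?_
    rw [integral_neg, integral_finsetSum _ fun j _ => integrable_sq_heatHessLog i j ht]
  · intro r hr x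
    have hr0 : 0 < r := by linarith [hr.1]
    have hp := heatFlow_pos (μ := μ) hr0 x
    refine (((hasDerivAt_heatFlow₁ i hr0 x).fun_pow 2).fun_div (hasDerivAt_heatFlow hr0 x)
      hp.ne').congr_deriv ?_
    have e : ∑ j, (heatFlow₁ μ i r x * heatFlow₃ μ i j r x / heatFlow μ r x
        - 1 / 2 * (heatFlow₁ μ i r x ^ 2 * heatFlow₂ μ j j r x / heatFlow μ r x ^ 2))
        = heatFlow₁ μ i r x / heatFlow μ r x * ∑ j, heatFlow₃ μ i j r x
          - 1 / 2 * heatFlow₁ μ i r x ^ 2 / heatFlow μ r x ^ 2 * ∑ j, heatFlow₂ μ j j r x := by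
      rw [Finset.mul_sum, Finset.mul_sum, ← Finset.sum_sub_distrib]
      exact Finset.sum_congr rfl fun j _ => by ring
    rw [e]
    field_simp
    ring
  · intro r hr x
    have hr0 : 0 < r := by linarith [hr.1]
    obtain ⟨-, h1, h4, h2, h3⟩ := h r hr x
    have := Finset.abs_sum_le_sum_abs (fun j => heatFlow₁ μ i r x * heatFlow₃ μ i j r x /
      heatFlow μ r x - 1 / 2 * (heatFlow₁ μ i r x ^ 2 * heatFlow₂ μ j j r x / heatFlow μ r x ^ 2))
      Finset.univ
    refine (this.trans (Finset.sum_le_sum fun j _ => abs_fisherTime_le (heatFlow_pos hr0 x) (h1 i)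
      (h4 i) (h2 j j) (h3 i j))).trans_eq ?_
    simp
  · exact (((integrable_heatFlow μ (by positivity)).const_mul C).const_mul 2).const_mul _
  · intro j
    refine integrable_of_abs_le_heatFlow (μ := μ) (C := 3 * C) (by fun_prop)
      (by positivity : 0 < 2 * t) fun x => ?_
    obtain ⟨-, h1, h4, h2, h3⟩ := h t hw x
    exact (abs_fisherGrad_le (heatFlow_pos ht x) (h1 i) (h4 i) (h1 j) (h2 i j)).trans_eq (by ring)
  · intro j
    refine integrable_of_abs_le_heatFlow (μ := μ) (C := 11 * C) (by fun_prop)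
      (by positivity : 0 < 2 * t) fun x => ?_
    obtain ⟨-, h1, h4, h2, h3⟩ := h t hw x
    exact (abs_fisherLaplacian_le (heatFlow_pos ht x) (h1 i) (h4 i) (h4 j) (h2 j j) (h2 i j)
      (h3 i j)).trans_eq (by ring)
  · intro j x
    have h0 : x + (0 : ℝ) • EuclideanSpace.single j (1 : ℝ) = x := by simp
    have := hasDerivAt_fisherGrad (s := 0)
      (a := fun s : ℝ => heatFlow₁ μ i t (x + s • EuclideanSpace.single j (1 : ℝ)))
      (c := fun s : ℝ => heatFlow₁ μ j t (x + s • EuclideanSpace.single j (1 : ℝ)))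
      (v := fun s : ℝ => heatFlow₂ μ i j t (x + s • EuclideanSpace.single j (1 : ℝ)))
      (p := fun s : ℝ => heatFlow μ t (x + s • EuclideanSpace.single j (1 : ℝ)))
      (u := heatFlow₂ μ j j t x) (w := heatFlow₃ μ i j t x) (heatFlow_pos ht _).ne'
      (by simp only [h0]; exact hasLineDerivAt_heatFlow₁ i j ht x)
      (hasLineDerivAt_heatFlow₁ j j ht x) (hasLineDerivAt_heatFlow₂ i j ht x)
      (by simp only [h0]; exact hasLineDerivAt_heatFlow j ht x)
    simp only [h0] at this
    exact this
  · intro x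
    have hp := heatFlow_pos (μ := μ) ht x
    rw [← sub_eq_add_neg, Finset.mul_sum, ← Finset.sum_sub_distrib]
    refine Finset.sum_congr rfl fun j _ => ?_
    rw [heatHessLog]
    field_simp
    ring

theorem hasDerivAt_fisherInfo {t : ℝ} (ht : 0 < t) :
    HasDerivAt (fisherInfo μ) (-hessianInfo μ t) t := by
  unfold hessianInfo
  rw [← Finset.sum_neg_distrib]
  exact HasDerivAt.fun_sum fun i _ => hasDerivAt_fisher i ht

/-- De Bruijn's identity. The divergence field is `G j = ∂ⱼ(-p log p)`, and what remains of `-½(log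
p + 1)Δp` is half the Fisher integrand. -/
theorem hasDerivAt_integral_negMulLog_heatFlow {t : ℝ} (ht : 0 < t)
    (hfin : ∀ t > 0, Integrable fun x => heatFlow μ t x * Real.log (heatFlow μ t x)) :
    HasDerivAt (fun t => -∫ x, heatFlow μ t x * Real.log (heatFlow μ t x))
      (1 / 2 * fisherInfo μ t) t := by
  obtain ⟨C, hC, h⟩ := exists_heatFlow_bounds μ ht
  obtain ⟨L, hL, hlog⟩ := exists_abs_log_heatFlow_le μ ht
  have hw := mem_Ioo_window ht
  have h2t : 0 < 2 * t := by positivity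
  -- Finiteness of the entropy at the later time `2t` makes the dominating function integrable.
  have hbi : Integrable fun x =>
      (1 + L) * C * (heatFlow μ (2 * t) x * (1 + |Real.log (heatFlow μ (2 * t) x)|)) := by
    refine Integrable.const_mul ?_ _
    refine ((integrable_heatFlow μ h2t).add (hfin _ h2t).norm).congr (ae_of_all _ fun x => ?_)
    simp only [Pi.add_apply, norm_mul, Real.norm_eq_abs, abs_of_pos (heatFlow_pos (μ := μ) h2t x)]
    ring
  have hbound (r) (hr : r ∈ Ioo (t / 2) (3 * t / 2)) (x) (a : ℝ)
      (ha : |a| ≤ C * heatFlow μ (2 * t) x) : |(Real.log (heatFlow μ r x) + 1) * a| ≤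
      (1 + L) * C * (heatFlow μ (2 * t) x * (1 + |Real.log (heatFlow μ (2 * t) x)|)) := by
    have hl := hlog r hr x
    have := abs_add_le (Real.log (heatFlow μ r x)) 1
    rw [abs_one] at this
    have h3 : |Real.log (heatFlow μ r x) + 1| ≤
        (1 + L) * (1 + |Real.log (heatFlow μ (2 * t) x)|) := by
      nlinarith [abs_nonneg (Real.log (heatFlow μ (2 * t) x))]
    rw [abs_mul]
    refine (mul_le_mul h3 ha (abs_nonneg _) ((abs_nonneg _).trans h3)).trans_eq ?_
    ring
  have hmain := hasDerivAt_integral_of_divergence (t := t)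
    (F := fun t x => -(heatFlow μ t x * Real.log (heatFlow μ t x)))
    (F' := fun t x => -(1 / 2 * ∑ j, (Real.log (heatFlow μ t x) + 1) * heatFlow₂ μ j j t x))
    (R := fun x => 1 / 2 * ∑ j, heatFlow₁ μ j t x ^ 2 / heatFlow μ t x)
    (bound := fun x => 1 / 2 * (n * ((1 + L) * C * (heatFlow μ (2 * t) x *
      (1 + |Real.log (heatFlow μ (2 * t) x)|)))))
    (G := fun j x => -((Real.log (heatFlow μ t x) + 1) * heatFlow₁ μ j t x))
    (G' := fun j x => -((Real.log (heatFlow μ t x) + 1) * heatFlow₂ μ j j t x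
      + heatFlow₁ μ j t x ^ 2 / heatFlow μ t x))
    (Ioo_mem_nhds hw.1 hw.2) (fun r => Measurable.aestronglyMeasurable (by fun_prop)) (hfin t ht).neg
    (Measurable.aestronglyMeasurable (by fun_prop))
    ?_ ?_ ((hbi.const_mul _).const_mul _) ?_ ?_ ?_ ?_
  · simp only [integral_neg] at hmain
    refine hmain.congr_deriv ?_
    rw [integral_const_mul, integral_finsetSum _ fun j _ => integrable_fisher j ht, fisherInfo]
  · intro r hr x
    have hr0 : 0 < r := by linarith [hr.1]
    have hp := heatFlow_pos (μ := μ) hr0 x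
    have hd := hasDerivAt_heatFlow (μ := μ) hr0 x
    refine (hd.fun_mul (hd.log hp.ne')).fun_neg.congr_deriv ?_
    rw [← Finset.mul_sum]
    field_simp
  · intro r hr x
    have hr0 : 0 < r := by linarith [hr.1]
    obtain ⟨h0, -, -, h2, -⟩ := h r hr x
    rw [abs_neg]
    exact abs_half_sum_le fun j => hbound r hr x _
      (abs_le_of_sq_le_mul (heatFlow_pos hr0 x) h0 (h2 j j))
  · intro j
    refine (hbi.mono' (by fun_prop) (ae_of_all _ fun x => ?_)).neg
    obtain ⟨h0, h1, -⟩ := h t hw x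
    exact hbound t hw x _ (abs_le_of_sq_le_mul (heatFlow_pos ht x) h0 (h1 j))
  · intro j
    refine (Integrable.add (hbi.mono' (by fun_prop) (ae_of_all _ fun x => ?_))
      (integrable_fisher j ht)).neg
    obtain ⟨h0, -, -, h2, -⟩ := h t hw x
    exact hbound t hw x _ (abs_le_of_sq_le_mul (heatFlow_pos ht x) h0 (h2 j j))
  · intro j x
    have hp := heatFlow_pos (μ := μ) ht x
    have h0 : x + (0 : ℝ) • EuclideanSpace.single j (1 : ℝ) = x := by simp
    have hd : HasDerivAt (fun s : ℝ => heatFlow μ t (x + s • EuclideanSpace.single j (1 : ℝ)))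
      (heatFlow₁ μ j t x) 0 := hasLineDerivAt_heatFlow j ht x
    have hd1 : HasDerivAt (fun s : ℝ => heatFlow₁ μ j t (x + s • EuclideanSpace.single j (1 : ℝ)))
      (heatFlow₂ μ j j t x) 0 := hasLineDerivAt_heatFlow₁ j j ht x
    refine (((hd.log (heatFlow_pos ht _).ne').add_const 1).fun_mul hd1).fun_neg.congr_deriv ?_
    simp only [h0]
    ring
  · intro x
    rw [Finset.sum_neg_distrib, Finset.sum_add_distrib]
    ring

theorem fisherInfo_nonneg {t : ℝ} (ht : 0 < t) : 0 ≤ fisherInfo μ t :=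
  Finset.sum_nonneg fun _ _ => integral_nonneg fun x =>
    div_nonneg (sq_nonneg _) (heatFlow_pos ht x).le

/-- Expand `∫ p(∂ᵢ∂ᵢ log p + c)² ≥ 0`. The cross term is `-2c ∫ (∂ᵢp)²/p`, because `∂ᵢ∂ᵢp`
integrates to zero, and the last is `c²`, because `p` has mass one. Sum over `i` and discard nothing
but nonnegative off-diagonal terms of `J`. -/
theorem two_mul_fisherInfo_sub_le_hessianInfo {t : ℝ} (ht : 0 < t) (c : ℝ) :
    2 * c * fisherInfo μ t - n * c ^ 2 ≤ hessianInfo μ t := by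
  have hdiag (i : Fin n) : 2 * c * ∫ x, heatFlow₁ μ i t x ^ 2 / heatFlow μ t x ≤
      (∫ x, heatHessLog μ i i t x ^ 2 / heatFlow μ t x) + c ^ 2 := by
    have i2 := integrable_heatFlow₂ (μ := μ) i i ht
    have i1 := integrable_fisher (μ := μ) i ht
    have ih := integrable_sq_heatHessLog (μ := μ) i i ht
    have i0 := integrable_heatFlow μ ht
    have hnn : 0 ≤ ∫ x, (heatHessLog μ i i t x + c * heatFlow μ t x) ^ 2 / heatFlow μ t x :=
      integral_nonneg fun x => div_nonneg (sq_nonneg _) (heatFlow_pos ht x).le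
    have e (x) : (heatHessLog μ i i t x + c * heatFlow μ t x) ^ 2 / heatFlow μ t x
        = heatHessLog μ i i t x ^ 2 / heatFlow μ t x + (2 * c * (heatFlow₂ μ i i t x
          - heatFlow₁ μ i t x ^ 2 / heatFlow μ t x) + c ^ 2 * heatFlow μ t x) := by
      have hp := heatFlow_pos (μ := μ) ht x
      rw [heatHessLog]
      field_simp
      ring
    simp_rw [e] at hnn
    have i3 : Integrable fun x => 2 * c * (heatFlow₂ μ i i t x
        - heatFlow₁ μ i t x ^ 2 / heatFlow μ t x) := (i2.sub i1).const_mul _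
    have i4 : Integrable fun x => 2 * c * (heatFlow₂ μ i i t x
        - heatFlow₁ μ i t x ^ 2 / heatFlow μ t x) + c ^ 2 * heatFlow μ t x :=
      i3.add (i0.const_mul _)
    rw [integral_add ih i4, integral_add i3 (i0.const_mul _), integral_const_mul,
      integral_const_mul, integral_sub i2 i1, integral_heatFlow₂ i i ht,
      integral_heatFlow μ ht] at hnn
    linarith
  have hle (i : Fin n) : ∫ x, heatHessLog μ i i t x ^ 2 / heatFlow μ t x ≤
      ∑ j, ∫ x, heatHessLog μ i j t x ^ 2 / heatFlow μ t x :=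
    Finset.single_le_sum (f := fun j => ∫ x, heatHessLog μ i j t x ^ 2 / heatFlow μ t x)
      (fun j _ => integral_nonneg fun x => div_nonneg (sq_nonneg _) (heatFlow_pos ht x).le)
      (Finset.mem_univ i)
  have hsum := Finset.sum_le_sum (s := (Finset.univ : Finset (Fin n))) fun i _ =>
    (hdiag i).trans (add_le_add_left (hle i) (c ^ 2))
  rw [← Finset.mul_sum, Finset.sum_add_distrib] at hsum
  simp only [Finset.sum_const, Finset.card_univ, Fintype.card_fin, nsmul_eq_mul] at hsum
  unfold fisherInfo hessianInfo
  linarith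

theorem sq_fisherInfo_le (hn : 0 < n) {t : ℝ} (ht : 0 < t) :
    fisherInfo μ t ^ 2 ≤ n * hessianInfo μ t := by
  have hn' : (0 : ℝ) < n := by exact_mod_cast hn
  -- The value `c = I/n` maximises `2cI - nc²`.
  have h := two_mul_fisherInfo_sub_le_hessianInfo (μ := μ) ht (fisherInfo μ t / n)
  have e : 2 * (fisherInfo μ t / n) * fisherInfo μ t - n * (fisherInfo μ t / n) ^ 2
      = fisherInfo μ t ^ 2 / n := by field_simp; ring
  rw [e, div_le_iff₀ hn'] at h
  linarith

end Derivatives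

/-! ### Entropy power and conclusion -/

theorem hasDerivAt_entropyPower_of_hasDerivAt {H I : ℝ → ℝ} {J t c : ℝ} (n : ℕ)
    (hH : HasDerivAt H (1 / 2 * I t) t) (hI : HasDerivAt I (-J) t) :
    HasDerivAt (fun t => c * Real.exp (2 / (n : ℝ) * H t))
      (c * Real.exp (2 / (n : ℝ) * H t) * (I t / n)) t ∧
    HasDerivAt (fun t => c * Real.exp (2 / (n : ℝ) * H t) * (I t / n))
      (c * Real.exp (2 / (n : ℝ) * H t) * (I t / n) * (I t / n)
        + c * Real.exp (2 / (n : ℝ) * H t) * (-J / n)) t := by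
  have h : HasDerivAt (fun t => c * Real.exp (2 / (n : ℝ) * H t))
      (c * Real.exp (2 / (n : ℝ) * H t) * (I t / n)) t :=
    ((hH.const_mul (2 / (n : ℝ))).exp.const_mul c).congr_deriv (by ring)
  exact ⟨h, h.fun_mul (hI.div_const (n : ℝ))⟩

theorem mainTheorem1 {Ω : Type*} [MeasurableSpace Ω] (P : Measure Ω) [IsProbabilityMeasure P]
    (n : ℕ) (hn : 0 < n)
    (X : Ω → EuclideanSpace ℝ (Fin n)) (hX : HasPDF X P volume)
    (Z : ℝ → Ω → EuclideanSpace ℝ (Fin n))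
    (hZ : ∀ t : ℝ, 0 < t →
      HasLaw (Z t) (multivariateGaussian 0 (t • (1 : Matrix (Fin n) (Fin n) ℝ))) P)
    (hindep : ∀ t : ℝ, 0 < t → IndepFun X (Z t) P)
    (hfin : ∀ t : ℝ, 0 < t → HasFiniteEntropy P (X + Z t)) :
    (∀ t : ℝ, 0 < t →
      DifferentiableAt ℝ (fun s : ℝ => entropyPower P (X + Z s)) t ∧
      DifferentiableAt ℝ (deriv (fun s : ℝ => entropyPower P (X + Z s))) t ∧
      0 ≤ deriv (fun s : ℝ => entropyPower P (X + Z s)) t ∧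
      deriv (deriv (fun s : ℝ => entropyPower P (X + Z s))) t ≤ 0) ∧
    ConcaveOn ℝ (Ioi (0 : ℝ)) (fun t : ℝ => entropyPower P (X + Z t)) := by
  have := Measure.isProbabilityMeasure_map hX.aemeasurable
  set μ := P.map X
  set H : ℝ → ℝ := fun t => -∫ x, heatFlow μ t x * Real.log (heatFlow μ t x) with hH
  set c : ℝ := 1 / (2 * Real.pi * Real.exp 1)
  set N : ℝ → ℝ := fun t => c * Real.exp (2 / (n : ℝ) * H t) with hN
  set f : ℝ → ℝ := fun t => entropyPower P (X + Z t) with hf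
  have hc : 0 < c := by positivity
  have hn' : (0 : ℝ) < n := by exact_mod_cast hn
  have hpdf t (ht : 0 < t) := pdf_add_gaussian_ae_eq hX.aemeasurable ht (hZ t ht) (hindep t ht)
  have hlog t (ht : 0 < t) : (fun x => (pdf (X + Z t) P volume x).toReal *
      Real.log (pdf (X + Z t) P volume x).toReal) =ᵐ[volume]
      fun x => heatFlow μ t x * Real.log (heatFlow μ t x) := by
    filter_upwards [hpdf t ht] with x hx
    rw [hx]
  have hint : ∀ t > 0, Integrable fun x => heatFlow μ t x * Real.log (heatFlow μ t x) :=
    fun t ht => (hfin t ht).congr (hlog t ht)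
  have hfN t (ht : 0 < t) : f t = N t := by
    simp only [hf, hN, hH, entropyPower, differentialEntropy]
    rw [integral_congr_ae (hlog t ht)]
  have hNpos t : 0 < N t := by positivity
  have hder t (ht : 0 < t) := hasDerivAt_entropyPower_of_hasDerivAt (c := c) n
    (hasDerivAt_integral_negMulLog_heatFlow ht hint) (hasDerivAt_fisherInfo ht)
  -- The formula for the entropy power is known only at positive times, so derivatives are
  -- transferred by agreement near `t`.
  have hf1 t (ht : 0 < t) : HasDerivAt f (N t * (fisherInfo μ t / n)) t := by
    refine (hder t ht).1.congr_of_eventuallyEq ?_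
    filter_upwards [Ioi_mem_nhds ht] with s hs using hfN s hs
  have hf2 t (ht : 0 < t) : HasDerivAt (deriv f) (N t * (fisherInfo μ t / n) * (fisherInfo μ t / n)
      + N t * (-hessianInfo μ t / n)) t := by
    refine (hder t ht).2.congr_of_eventuallyEq ?_
    filter_upwards [Ioi_mem_nhds ht] with s hs using (hf1 s hs).deriv
  have hle t (ht : 0 < t) : deriv (deriv f) t ≤ 0 := by
    rw [(hf2 t ht).deriv]
    -- The second derivative is `N (I² - nJ)/n²`, whose sign is that of `I² - nJ`.
    have e : N t * (fisherInfo μ t / n) * (fisherInfo μ t / n) + N t * (-hessianInfo μ t / n)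
        = N t * ((fisherInfo μ t ^ 2 - n * hessianInfo μ t) / n ^ 2) := by
      field_simp
      ring
    rw [e]
    exact mul_nonpos_of_nonneg_of_nonpos (hNpos t).le
      (div_nonpos_of_nonpos_of_nonneg (by linarith [sq_fisherInfo_le (μ := μ) hn ht])
        (by positivity))
  refine ⟨fun t ht => ⟨(hf1 t ht).differentiableAt, (hf2 t ht).differentiableAt, ?_, hle t ht⟩, ?_⟩
  · rw [(hf1 t ht).deriv]
    exact mul_nonneg (hNpos t).le (div_nonneg (fisherInfo_nonneg ht) hn'.le)
  · refine concaveOn_of_deriv2_nonpos (convex_Ioi 0)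
      (fun t ht => (hf1 t ht).continuousAt.continuousWithinAt) ?_ ?_ ?_
    all_goals rw [interior_Ioi]
    · exact fun t ht => (hf1 t ht).differentiableAt.differentiableWithinAt
    · exact fun t ht => (hf2 t ht).differentiableAt.differentiableWithinAt
    · exact fun t ht => hle t ht
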